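/- Let $X$ be an $n$-dimensional Euclidean space with dual $X^*$, and write $\langle x\rangle=(1+|x|^2)^{1/2}$. For a Euclidean space $V$ and $r\in\mathbb R$, let $\mathcal S^{r}(V)$ be the set of $C^\infty$ functions $a:V\to\mathbb C$ such that for every $k\in\mathbb N$ there is $C_k>0$ with $\|a^{(k)}(x)\|\le C_k\langle x\rangle^{r-k}$ for all $x\in V$. Let $\mathcal U_0$ be the set of invertible endomorphisms of $X$ and $\mathcal U_1=1_X+\mathcal U_0$, with the topology of $\operatorname{End}_{\mathbb R}(X)$. Let $\mathcal F^{-1}$ be the inverse Fourier transform, $(\mathcal F^{-1}a)(x)=(2\pi)^{-n}\int_{X^*}e^{i\langle x,p\rangle}a(p)\,dp$ for integrable $a$ on $X^*$, and let $(1-\Delta)^{m/2}$ be the operator on tempered distributions on $X$ that multiplies the Fourier transform by $\langle p\rangle^m$. Let $s,t>n$ and $m\in(n/2,t/2)$. Let $a\in\mathcal S^{-t}(X^*)$, $b\in\mathcal S^{-s}(X)$ and $c\in\mathcal S^{s/2}(X)$. For $\tau\in\operatorname{End}_{\mathbb R}(X)$ put $$\mathcal K_{a,b}(x,y;\tau)=b(x-y)\,(\mathcal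 F^{-1}a)\big((1-\tau)x+\tau y\big),\qquad (x,y)\in X\times X.$$ (i) If $\tau\in\mathcal U_1$, then for every $y\in X$ the functions $c(\cdot)\mathcal K_{a,b}(\cdot,y;\tau)$ and $(1-\Delta)^{m/2}\big(c(\cdot)\mathcal K_{a,b}(\cdot,y;\tau)\big)$ are in $L^2(X)$, and $$\mathcal K^1_{a,b,c}(x,y;\tau)=(1-\Delta)^{m/2}\big(c(\cdot)\mathcal K_{a,b}(\cdot,y;\tau)\big)(x)$$ (with suitable representatives for each $y$) defines a function in $L^2(X\times X)$. The mapping $\mathcal U_1\ni\tau\mapsto\mathcal K^1_{a,b,c}(\cdot,\cdot;\tau)\in L^2(X\times X)$ is continuous. (ii) If $\tau\in\mathcal U_0$, then for every $x\in X$ the functions $c(\cdot)\mathcal K_{a,b}(x,\cdot;\tau)$ and $(1-\Delta)^{m/2}\big(c(\cdot)\mathcal K_{a,b}(x,\cdot;\tau)\big)$ are in $L^2(X)$, and $$\mathcal K^0_{a,b,c}(x,y;\tau)=(1-\Delta)^{m/2}\big(c(\cdot)\mathcal K_{a,b}(x,\cdot;\tau)\big)(y)$$ (with suitable representatives for each $x$)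 defines a function in $L^2(X\times X)$. The mapping $\mathcal U_0\ni\tau\mapsto\mathcal K^0_{a,b,c}(\cdot,\cdot;\tau)\in L^2(X\times X)$ is continuous. -/

import Mathlib

open MeasureTheory
open scoped ContDiff SchwartzMap

noncomputable section

/-- `IsSymbol m a`: the function `a : V → ℂ` is a symbol of degree `m`, i.e. `a ∈ S^m(V)`:
it is smooth and `‖a⁽ᵏ⁾(x)‖ ≤ C_k ⟨x⟩^(m - k)` with `⟨x⟩ = (1 + |x|²)^(1/2)`, for every `k`. -/
def IsSymbol {V : Type*} [NormedAddCommGroup V] [NormedSpace ℝ V] (m : ℝ) (a : V → ℂ) : Prop :=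
  ContDiff ℝ ∞ a ∧
    ∀ k : ℕ, ∃ C : ℝ, 0 < C ∧
      ∀ x : V, ‖iteratedFDeriv ℝ k a x‖ ≤ C * (√(1 + ‖x‖ ^ 2)) ^ (m - (k : ℝ))

section

variable {X : Type*} [NormedAddCommGroup X] [InnerProductSpace ℝ X] [FiniteDimensional ℝ X]
  [MeasurableSpace X] [BorelSpace X]

/-- Lebesgue measure of the dual Euclidean space `X*`: the image of Lebesgue measure of `X` under
the isometric isomorphism `X ≃ X*` given by the inner product. -/
def dualVolume (X : Type*) [NormedAddCommGroup X] [InnerProductSpace ℝ X] [FiniteDimensional ℝ X]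
    [MeasurableSpace X] [BorelSpace X] : Measure (StrongDual ℝ X) :=
  Measure.map (fun v : X => InnerProductSpace.toDual ℝ X v) volume

/-- The inverse Fourier transform
`(F⁻¹ a)(x) = (2π)⁻ⁿ ∫_{X*} e^{i⟨x, p⟩} a(p) dp` of an integrable function `a` on `X*`. -/
def invFourierDual (a : StrongDual ℝ X → ℂ) (x : X) : ℂ :=
  (((2 * Real.pi) ^ Module.finrank ℝ X)⁻¹ : ℝ) *
    ∫ p, Complex.exp (Complex.I * (p x : ℝ)) * a p ∂(dualVolume X)

/-- The operator `(1 - Δ)^(m/2)` on tempered distributions on `X`. With Mathlib's normalization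
`∫ e^{-2πi⟨x, ξ⟩} u(x) dx` of the Fourier transform, it is the Fourier multiplier with symbol
`(1 + |2πξ|²)^(m/2)`. -/
def oneSubLaplacianPow (X : Type*) [NormedAddCommGroup X] [InnerProductSpace ℝ X]
    [FiniteDimensional ℝ X] [MeasurableSpace X] [BorelSpace X] (m : ℝ) :
    𝓢'(X, ℂ) →L[ℂ] 𝓢'(X, ℂ) :=
  TemperedDistribution.fourierMultiplierCLM ℂ
    (fun ξ : X => (((1 + ‖(2 * Real.pi) • ξ‖ ^ 2) ^ (m / 2) : ℝ) : ℂ))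

/-- `HasOneSubLaplacianPow m u w`: the functions `u` and `w` are in `L²(X)` and
`(1 - Δ)^(m/2) u = w` as tempered distributions. -/
def HasOneSubLaplacianPow (m : ℝ) (u w : X → ℂ) : Prop :=
  ∃ (hu : MemLp u 2 volume) (hw : MemLp w 2 volume),
    oneSubLaplacianPow X m (Lp.toTemperedDistribution (hu.toLp u)) =
      Lp.toTemperedDistribution (hw.toLp w)

/-- The kernel `K_{a,b}(x, y; τ) = b(x - y) (F⁻¹a)((1 - τ)x + τy)`. -/
def cordesKernel (a : StrongDual ℝ X → ℂ) (b : X → ℂ) (τ : X →L[ℝ] X) (x y : X) : ℂ :=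
  b (x - y) * invFourierDual a ((1 - τ) x + τ y)

end

/-- The set `U₀` of invertible endomorphisms of `X`. -/
def cordesU₀ (X : Type*) [NormedAddCommGroup X] [NormedSpace ℝ X] : Set (X →L[ℝ] X) :=
  {τ | IsUnit τ}

/-- The set `U₁ = 1 + U₀`. -/
def cordesU₁ (X : Type*) [NormedAddCommGroup X] [NormedSpace ℝ X] : Set (X →L[ℝ] X) :=
  (fun σ => 1 + σ) '' cordesU₀ X

end

/-! Everything rests on a bound for the Fourier transform of one slice that is square integrable in
frequency and in the frozen variable. Put v = (1-τ)x + τy. Integration by parts gives F⁻¹a(v) =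
(1+|v|²)^(-M) ∫ e^{i⟨p,v⟩} A(p) dp, where A is a multiple of (1-Δ)^M a and still O((1+|p|)^(-t)).
The slice x ↦ c(x) K(x,y;τ) is therefore a smooth amplitude times a superposition of plane waves.

Since x = v + τ(x-y) and y = v - (1-τ)(x-y), the decay of b in x-y and of the bracket in v outweighs
the growth of c and leaves a factor (1+|y|)^(-s/2), with integrable decay in x around -(1-τ)⁻¹τy
(`exists_norm_iteratedFDeriv_sliceAmplitude_le`). In frequency, the plane waves turn the transform
of the slice into a convolution-type integral of A with the rapidly decaying transform of the
amplitude, so it is O((1+|y|)^(-s/2) (1+|w|)^(-t)) (`exists_norm_kernelSlice_le`). After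
multiplication by the symbol of order m this is in L² in w because t-m > t/2 > n/2, and in y because
s > n.

The constants are locally uniform in τ, so dominated convergence makes the L² class of the slice
continuous in (τ,y), and `exists_memLp_prod_representative` assembles the slices into functions on
the product, continuously in τ. Part (ii) is part (i) after exchanging x and y, reflecting b and
replacing τ by 1-τ. -/

section
open Filter Topology
open scoped ENNReal

/-! ### L² norms: dominated convergence and Fubini. -/

section FubiniL2

variable {α β E : Type*} [MeasurableSpace α] [MeasurableSpace β] [NormedAddCommGroup E]

theorem eLpNorm_two_sq_eq_lintegral (f : α → E) (μ : Measure α) :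
    eLpNorm f 2 μ ^ 2 = ∫⁻ x, ‖f x‖ₑ ^ 2 ∂μ := by
  have := eLpNorm_nnreal_pow_eq_lintegral (μ := μ) (f := f) (p := 2) two_ne_zero
  rw [← ENNReal.rpow_two]
  simpa only [ENNReal.coe_ofNat, NNReal.coe_ofNat, ENNReal.rpow_two] using this

theorem tendsto_eLpNorm_two_sub_of_dominated {ι : Type*} {l : Filter ι} [l.IsCountablyGenerated]
    {μ : Measure α} {F : ι → α → E} {f : α → E} (hF : ∀ i, AEStronglyMeasurable (F i) μ)
    (hf : AEStronglyMeasurable f μ) {g : α → ℝ} (hg : MemLp g 2 μ)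
    (hFg : ∀ᶠ i in l, ∀ᵐ x ∂μ, ‖F i x‖ ≤ g x) (hfg : ∀ᵐ x ∂μ, ‖f x‖ ≤ g x)
    (hlim : ∀ᵐ x ∂μ, Tendsto (fun i => F i x) l (𝓝 (f x))) :
    Tendsto (fun i => eLpNorm (F i - f) 2 μ) l (𝓝 0) := by
  have key : Tendsto (fun i => ∫⁻ x, ‖(F i - f) x‖ₑ ^ 2 ∂μ) l (𝓝 (∫⁻ _, 0 ∂μ)) := by
    refine tendsto_lintegral_filter_of_dominated_convergence' (fun x => ‖(2 : ℝ) * g x‖ₑ ^ 2)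
      (Eventually.of_forall fun i => ?_) ?_ ?_ ?_
    · exact (((hF i).sub hf).enorm).pow_const 2
    · filter_upwards [hFg] with i hi
      filter_upwards [hi, hfg] with x h1 h2
      gcongr
      rw [enorm_le_iff_norm_le]
      calc ‖(F i - f) x‖ ≤ ‖F i x‖ + ‖f x‖ := norm_sub_le _ _
        _ ≤ 2 * g x := by linarith
        _ ≤ ‖2 * g x‖ := Real.le_norm_self _
    · rw [← eLpNorm_two_sq_eq_lintegral]
      exact ENNReal.pow_ne_top (hg.const_mul 2).eLpNorm_ne_top
    · filter_upwards [hlim] with x hx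
      have h1 : Tendsto (fun i => (F i - f) x) l (𝓝 0) := by
        simpa using hx.sub_const (f x)
      have h2 := (ENNReal.continuous_pow 2).tendsto _ |>.comp h1.enorm
      simpa [Function.comp_def] using h2
  simp only [lintegral_zero, ← eLpNorm_two_sq_eq_lintegral] at key
  have := ((ENNReal.continuous_rpow_const (y := (1 / 2 : ℝ))).tendsto 0).comp key
  rw [ENNReal.zero_rpow_of_pos (by norm_num)] at this
  refine this.congr fun i => ?_
  rw [Function.comp_apply, ← ENNReal.rpow_natCast, ← ENNReal.rpow_mul]
  simp

theorem eLpNorm_two_sq_prod {μ : Measure α} {ν : Measure β} [SFinite μ] [SFinite ν]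
    {f : α × β → E} (hf : AEStronglyMeasurable f (μ.prod ν)) :
    eLpNorm f 2 (μ.prod ν) ^ 2 = ∫⁻ y, eLpNorm (fun x => f (x, y)) 2 μ ^ 2 ∂ν := by
  simp_rw [eLpNorm_two_sq_eq_lintegral]
  exact lintegral_prod_symm _ (hf.enorm.pow_const 2)

end FubiniL2

/-! ### From a family of L² classes to a function on the product. -/

section JointRepresentative

variable {α β : Type*} [MeasurableSpace α] [MeasurableSpace β]
  {μ : Measure α} {ν : Measure β}

/-- The squared errors have summable integrals, so their sum is finite almost everywhere and its
terms tend to zero. No subsequence is needed. -/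
theorem ae_tendsto_of_eLpNorm_two_sub_le {F : ℕ → α → ℂ} {f : α → ℂ}
    (hF : ∀ n, AEStronglyMeasurable (F n) μ) (hf : AEStronglyMeasurable f μ)
    (h : ∀ n, eLpNorm (F n - f) 2 μ ≤ 2⁻¹ ^ n) :
    ∀ᵐ x ∂μ, Tendsto (fun n => F n x) atTop (𝓝 (f x)) := by
  have hmeas : ∀ n, AEMeasurable (fun x => ‖(F n - f) x‖ₑ ^ 2) μ :=
    fun n => ((hF n).sub hf).enorm.pow_const 2
  have hsum : ∫⁻ x, ∑' n, ‖(F n - f) x‖ₑ ^ 2 ∂μ ≠ ⊤ := by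
    rw [lintegral_tsum hmeas]
    refine ne_top_of_le_ne_top (b := ∑' n : ℕ, (2⁻¹ : ℝ≥0∞) ^ n) ?_ ?_
    · rw [ENNReal.tsum_geometric]; norm_num
    · refine ENNReal.tsum_le_tsum fun n => ?_
      rw [← eLpNorm_two_sq_eq_lintegral]
      calc eLpNorm (F n - f) 2 μ ^ 2 ≤ (2⁻¹ ^ n) ^ 2 := by gcongr; exact h n
        _ ≤ 2⁻¹ ^ n := by
          rw [← pow_mul]
          exact pow_le_pow_right_of_le_one' (by norm_num) (by omega)
  filter_upwards [ae_lt_top' (AEMeasurable.tsum hmeas) hsum] with x hx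
  have h0 := ENNReal.tendsto_atTop_zero_of_tsum_ne_top hx.ne
  have h1 := ((ENNReal.continuous_rpow_const (y := (1 / 2 : ℝ))).tendsto 0).comp h0
  rw [ENNReal.zero_rpow_of_pos (by norm_num)] at h1
  have h2 : Tendsto (fun n => ‖F n x - f x‖ₑ) atTop (𝓝 0) := by
    refine h1.congr fun n => ?_
    rw [Function.comp_apply, ← ENNReal.rpow_natCast, ← ENNReal.rpow_mul]
    simp
  rw [tendsto_iff_edist_tendsto_0]
  simpa [edist_eq_enorm_sub] using h2

/-- A continuous family of `L²` classes has a jointly measurable representative that is correct for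
every value of the parameter. -/
theorem exists_measurable_representative [TopologicalSpace β] [OpensMeasurableSpace β]
    [IsSeparable μ] (W : β → Lp ℂ 2 μ) (hW : Continuous W) :
    ∃ K : α × β → ℂ, StronglyMeasurable K ∧ ∀ y, (fun x => K (x, y)) =ᵐ[μ] W y := by
  classical
  have : Fact ((2 : ℝ≥0∞) ≠ ⊤) := ⟨ENNReal.ofNat_ne_top⟩
  let q : ℕ → Lp ℂ 2 μ := TopologicalSpace.denseSeq _
  have hq : DenseRange q := TopologicalSpace.denseRange_denseSeq _
  have hex : ∀ (j : ℕ) (y : β), ∃ i, dist (q i) (W y) < 2⁻¹ ^ j := fun j y => by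
    obtain ⟨i, hi⟩ := hq.exists_dist_lt (W y) (show (0 : ℝ) < 2⁻¹ ^ j by positivity)
    exact ⟨i, by rwa [dist_comm]⟩
  -- Taking the least admissible index makes the choice measurable in y. The approximants then take
  -- countably many values in L², which gives joint measurability, and their pointwise limit is
  -- correct on every slice.
  let idx : ℕ → β → ℕ := fun j y => Nat.find (hex j y)
  have hidx : ∀ j, Measurable (idx j) := fun j => by
    refine measurable_find _ fun i => ?_
    exact measurableSet_lt (continuous_const.dist hW).measurable measurable_const
  let F : ℕ → α × β → ℂ := fun j z => q (idx j z.2) z.1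
  have hF : ∀ j, StronglyMeasurable (F j) := fun j => by
    have h1 : Measurable (fun z : α × ℕ => q z.2 z.1) :=
      measurable_from_prod_countable_left fun i => (Lp.stronglyMeasurable (q i)).measurable
    exact (h1.comp (measurable_fst.prodMk ((hidx j).comp measurable_snd))).stronglyMeasurable
  refine ⟨fun z => limUnder atTop fun j => F j z, StronglyMeasurable.limUnder hF, fun y => ?_⟩
  have := ae_tendsto_of_eLpNorm_two_sub_le (μ := μ) (F := fun j => q (idx j y)) (f := W y)
    (fun n => Lp.aestronglyMeasurable _) (Lp.aestronglyMeasurable _) fun n => by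
      have h := (Nat.find_spec (hex n y)).le
      rw [← Lp.edist_def, edist_dist]
      exact (ENNReal.ofReal_le_ofReal h).trans_eq (by
        rw [ENNReal.ofReal_pow (by norm_num), ENNReal.ofReal_inv_of_pos two_pos,
          ENNReal.ofReal_ofNat])
  filter_upwards [this] with x hx
  exact hx.limUnder_eq

/-- By Fubini, the product norm is the L² norm in y of the slice norms, so the majorant g gives both
membership in L² and, by dominated convergence in y, continuity in τ. -/
theorem exists_memLp_prod_representative {T : Type*} [TopologicalSpace T]
    [FirstCountableTopology T] [TopologicalSpace β] [OpensMeasurableSpace β] [IsSeparable μ]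
    [SFinite μ] [SFinite ν]
    (W : T → β → Lp ℂ 2 μ) (hW : Continuous fun z : T × β => W z.1 z.2)
    (hbound : ∀ τ₀, ∃ g : β → ℝ, MemLp g 2 ν ∧ ∀ᶠ τ in 𝓝 τ₀, ∀ y, ‖W τ y‖ ≤ g y) :
    ∃ (K : T → α × β → ℂ) (hK : ∀ τ, MemLp (K τ) 2 (μ.prod ν)),
      (∀ τ y, (fun x => K τ (x, y)) =ᵐ[μ] W τ y) ∧ Continuous fun τ => (hK τ).toLp (K τ) := by
  have : Fact ((2 : ℝ≥0∞) ≠ ⊤) := ⟨ENNReal.ofNat_ne_top⟩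
  have hWτ : ∀ τ, Continuous (W τ) := fun τ => hW.comp (Continuous.prodMk_right τ)
  choose K hKm hKW using fun τ => exists_measurable_representative (W τ) (hWτ τ)
  have hsub : ∀ τ τ' y, eLpNorm (fun x => (K τ - K τ') (x, y)) 2 μ = ‖W τ y - W τ' y‖ₑ :=
    fun τ τ' y => by
      rw [Lp.enorm_def]
      refine eLpNorm_congr_ae ?_
      filter_upwards [hKW τ y, hKW τ' y, Lp.coeFn_sub (W τ y) (W τ' y)] with x h1 h2 h3
      rw [h3]; simp [h1, h2]
  have hK : ∀ τ, MemLp (K τ) 2 (μ.prod ν) := fun τ => by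
    obtain ⟨g, hg, hle⟩ := hbound τ
    refine ⟨(hKm τ).aestronglyMeasurable, ?_⟩
    have : eLpNorm (K τ) 2 (μ.prod ν) ^ 2 < ⊤ := by
      rw [eLpNorm_two_sq_prod (hKm τ).aestronglyMeasurable]
      calc ∫⁻ y, eLpNorm (fun x => K τ (x, y)) 2 μ ^ 2 ∂ν ≤ ∫⁻ y, ‖g y‖ₑ ^ 2 ∂ν := by
            refine lintegral_mono fun y => ?_
            dsimp only
            rw [eLpNorm_congr_ae (hKW τ y), ← Lp.enorm_def]
            gcongr
            rw [enorm_le_iff_norm_le]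
            exact (hle.self_of_nhds y).trans (Real.le_norm_self _)
        _ < ⊤ := by
            rw [← eLpNorm_two_sq_eq_lintegral]
            exact ENNReal.pow_lt_top hg.eLpNorm_lt_top
    by_contra htop
    simp only [not_lt, top_le_iff] at htop
    simp [htop] at this
  refine ⟨K, hK, hKW, continuous_iff_continuousAt.2 fun τ₀ => ?_⟩
  rw [ContinuousAt, Lp.tendsto_Lp_iff_tendsto_eLpNorm'']
  obtain ⟨g, hg, hle⟩ := hbound τ₀
  have key := tendsto_eLpNorm_two_sub_of_dominated (μ := ν) (l := 𝓝 τ₀) (F := W) (f := W τ₀)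
    (fun τ => (hWτ τ).aestronglyMeasurable) (hWτ τ₀).aestronglyMeasurable hg
    (hle.mono fun τ h => Eventually.of_forall h) (Eventually.of_forall hle.self_of_nhds)
    (Eventually.of_forall fun y =>
      (hW.comp (Continuous.prodMk_left y)).tendsto τ₀)
  refine key.congr fun τ => ?_
  refine (ENNReal.pow_right_strictMono two_ne_zero).injective ?_
  rw [eLpNorm_two_sq_prod ((hKm τ).sub (hKm τ₀)).aestronglyMeasurable,
    eLpNorm_two_sq_eq_lintegral]
  exact lintegral_congr fun y => by rw [hsub, Pi.sub_apply]

end JointRepresentative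
end

/-! ### Elementary weight inequalities. -/

section Weights

variable {V W : Type*} [NormedAddCommGroup V] [NormedAddCommGroup W]

theorem one_add_norm_add_le (x y : V) : 1 + ‖x + y‖ ≤ (1 + ‖x‖) * (1 + ‖y‖) := by
  nlinarith [norm_add_le x y, norm_nonneg x, norm_nonneg y, mul_nonneg (norm_nonneg x) (norm_nonneg y)]

theorem one_add_norm_apply_le [NormedSpace ℝ V] [NormedSpace ℝ W] (L : V →L[ℝ] W) (x : V) :
    1 + ‖L x‖ ≤ (1 + ‖L‖) * (1 + ‖x‖) := by
  nlinarith [L.le_opNorm x, norm_nonneg x, norm_nonneg L, mul_nonneg (norm_nonneg L) (norm_nonneg x)]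

/-- The bracket lies between (1+|x|)/2 and 1+|x|; the factor 2^|r| covers both signs of r. The gain
from the k derivatives is discarded. -/
theorem sqrt_one_add_sq_rpow_le (r : ℝ) (k : ℕ) (x : V) :
    √(1 + ‖x‖ ^ 2) ^ (r - k) ≤ 2 ^ |r| * (1 + ‖x‖) ^ r := by
  have hx := norm_nonneg x
  have h1 : 1 ≤ √(1 + ‖x‖ ^ 2) := Real.one_le_sqrt.2 (by nlinarith)
  have h2 : √(1 + ‖x‖ ^ 2) ≤ 1 + ‖x‖ := sqrt_one_add_norm_sq_le x
  have h3 : (1 + ‖x‖) / 2 ≤ √(1 + ‖x‖ ^ 2) := by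
    apply Real.le_sqrt_of_sq_le
    nlinarith [sq_nonneg (1 - ‖x‖)]
  calc √(1 + ‖x‖ ^ 2) ^ (r - k) ≤ √(1 + ‖x‖ ^ 2) ^ r :=
        Real.rpow_le_rpow_of_exponent_le h1 (by simp)
    _ ≤ 2 ^ |r| * (1 + ‖x‖) ^ r := by
      rcases le_or_gt 0 r with hr | hr
      · calc √(1 + ‖x‖ ^ 2) ^ r ≤ (1 + ‖x‖) ^ r := Real.rpow_le_rpow (by positivity) h2 hr
          _ ≤ 2 ^ |r| * (1 + ‖x‖) ^ r :=
            le_mul_of_one_le_left (by positivity)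
              (Real.one_le_rpow one_le_two (abs_nonneg r))
      · calc √(1 + ‖x‖ ^ 2) ^ r ≤ ((1 + ‖x‖) / 2) ^ r :=
              Real.rpow_le_rpow_of_nonpos (by positivity) h3 hr.le
          _ = 2 ^ |r| * (1 + ‖x‖) ^ r := by
            rw [Real.div_rpow (by positivity) two_pos.le, abs_of_neg hr,
              Real.rpow_neg two_pos.le, div_eq_inv_mul]

end Weights

/-! ### Functions whose derivatives all share one growth rate. -/

section SymbolBound

variable {V F : Type*} [NormedAddCommGroup V] [NormedSpace ℝ V] [NormedAddCommGroup F]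
  [NormedSpace ℝ F]

/-- `f` is smooth and all its derivatives are `O((1 + ‖x‖) ^ r)`. -/
def HasDerivGrowth (r : ℝ) (f : V → F) : Prop :=
  ContDiff ℝ ∞ f ∧ ∀ k : ℕ, ∃ C : ℝ, 0 ≤ C ∧
    ∀ x : V, ‖iteratedFDeriv ℝ k f x‖ ≤ C * (1 + ‖x‖) ^ r

theorem IsSymbol.hasDerivGrowth {r : ℝ} {f : V → ℂ} (hf : IsSymbol r f) :
    HasDerivGrowth r f := by
  refine ⟨hf.1, fun k => ?_⟩
  obtain ⟨C, hC, h⟩ := hf.2 k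
  refine ⟨C * 2 ^ |r|, by positivity, fun x => (h x).trans ?_⟩
  rw [mul_assoc]
  gcongr
  exact sqrt_one_add_sq_rpow_le r k x

namespace HasDerivGrowth

variable {r : ℝ} {f g : V → F}

theorem exists_uniform_bound (hf : HasDerivGrowth r f) (N : ℕ) :
    ∃ C : ℝ, 0 ≤ C ∧ ∀ k ≤ N, ∀ x : V, ‖iteratedFDeriv ℝ k f x‖ ≤ C * (1 + ‖x‖) ^ r := by
  choose C hC h using hf.2
  refine ⟨∑ k ∈ Finset.range (N + 1), C k, Finset.sum_nonneg fun k _ => hC k,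
    fun k hk x => (h k x).trans ?_⟩
  gcongr
  exact Finset.single_le_sum (fun i _ => hC i) (Finset.mem_range.2 (by omega))

theorem exists_norm_le (hf : HasDerivGrowth r f) :
    ∃ C : ℝ, 0 ≤ C ∧ ∀ x : V, ‖f x‖ ≤ C * (1 + ‖x‖) ^ r := by
  simpa using hf.2 0

theorem fderiv_apply (hf : HasDerivGrowth r f) (e : V) :
    HasDerivGrowth r (fun x => fderiv ℝ f x e) := by
  have hd : ContDiff ℝ ∞ (fderiv ℝ f) := hf.1.fderiv_right (by simp)
  refine ⟨hd.clm_apply contDiff_const, fun k => ?_⟩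
  obtain ⟨C, hC, h⟩ := hf.2 (k + 1)
  refine ⟨‖e‖ * C, by positivity, fun x => ?_⟩
  refine (norm_iteratedFDeriv_clm_apply_const hd.contDiffAt (by exact_mod_cast le_top)).trans ?_
  rw [norm_iteratedFDeriv_fderiv, mul_assoc]
  gcongr
  exact h x

theorem add (hf : HasDerivGrowth r f) (hg : HasDerivGrowth r g) :
    HasDerivGrowth r (f + g) := by
  refine ⟨hf.1.add hg.1, fun k => ?_⟩
  obtain ⟨C, hC, h⟩ := hf.2 k
  obtain ⟨D, hD, h'⟩ := hg.2 k
  refine ⟨C + D, by positivity, fun x => ?_⟩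
  rw [iteratedFDeriv_add_apply (hf.1.contDiffAt.of_le (by exact_mod_cast le_top))
    (hg.1.contDiffAt.of_le (by exact_mod_cast le_top)), add_mul]
  exact (norm_add_le _ _).trans (add_le_add (h x) (h' x))

theorem sub (hf : HasDerivGrowth r f) (hg : HasDerivGrowth r g) :
    HasDerivGrowth r (f - g) := by
  refine ⟨hf.1.sub hg.1, fun k => ?_⟩
  obtain ⟨C, hC, h⟩ := hf.2 k
  obtain ⟨D, hD, h'⟩ := hg.2 k
  refine ⟨C + D, by positivity, fun x => ?_⟩
  rw [iteratedFDeriv_sub_apply (hf.1.contDiffAt.of_le (by exact_mod_cast le_top))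
    (hg.1.contDiffAt.of_le (by exact_mod_cast le_top)), add_mul]
  exact (norm_sub_le _ _).trans (add_le_add (h x) (h' x))

theorem zero : HasDerivGrowth r (0 : V → F) := by
  refine ⟨contDiff_const, fun k => ⟨0, le_rfl, fun x => ?_⟩⟩
  simp

theorem sum {ι : Type*} (s : Finset ι) {f : ι → V → F} (hf : ∀ i ∈ s, HasDerivGrowth r (f i)) :
    HasDerivGrowth r (∑ i ∈ s, f i) :=
  Finset.sum_induction f (HasDerivGrowth r) (fun _ _ => add) zero hf

theorem comp_linearIsometryEquiv {W : Type*} [NormedAddCommGroup W] [NormedSpace ℝ W]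
    (hf : HasDerivGrowth r f) (e : W ≃ₗᵢ[ℝ] V) : HasDerivGrowth r (fun x => f (e x)) := by
  refine ⟨hf.1.comp e.contDiff, fun k => ?_⟩
  obtain ⟨C, hC, h⟩ := hf.2 k
  refine ⟨C, hC, fun x => ?_⟩
  have := e.norm_iteratedFDeriv_comp_right (𝕜 := ℝ) f x k
  rw [Function.comp_def] at this
  rw [this, ← e.norm_map x]
  exact h _

variable [FiniteDimensional ℝ V] [MeasurableSpace V] [BorelSpace V] {μ : Measure V}
  [μ.IsAddHaarMeasure]

theorem _root_.integrable_of_norm_le_one_add_norm_rpow {E : Type*} [NormedAddCommGroup E]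
    {f : V → E} {t C : ℝ} (ht : (Module.finrank ℝ V : ℝ) < t)
    (hf : AEStronglyMeasurable f μ) (h : ∀ x, ‖f x‖ ≤ C * (1 + ‖x‖) ^ (-t)) : Integrable f μ :=
  ((integrable_one_add_norm ht).const_mul C).mono' hf (.of_forall h)

theorem integrable {t : ℝ} (ht : (Module.finrank ℝ V : ℝ) < t) (hf : HasDerivGrowth (-t) f) :
    Integrable f μ := by
  obtain ⟨C, -, h⟩ := hf.exists_norm_le
  exact integrable_of_norm_le_one_add_norm_rpow ht hf.1.continuous.aestronglyMeasurable h

theorem integrable_fderiv {t : ℝ} (ht : (Module.finrank ℝ V : ℝ) < t)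
    (hf : HasDerivGrowth (-t) f) : Integrable (fderiv ℝ f) μ := by
  obtain ⟨C, -, h⟩ := hf.2 1
  refine integrable_of_norm_le_one_add_norm_rpow (C := C) ht
    (hf.1.continuous_fderiv (by simp)).aestronglyMeasurable fun x => ?_
  simpa [norm_iteratedFDeriv_one] using h x

end HasDerivGrowth

end SymbolBound

/-! ### The inverse Fourier transform and integration by parts. -/

section ExpIntegral

open FourierTransform Real Complex
open scoped RealInnerProductSpace

variable {X : Type*} [NormedAddCommGroup X] [InnerProductSpace ℝ X] [FiniteDimensional ℝ X]
  [MeasurableSpace X] [BorelSpace X]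

/-- The unnormalized inverse Fourier transform `∫ e^{i⟨p, x⟩} A(p) dp`. -/
noncomputable def expIntegral (A : X → ℂ) (x : X) : ℂ :=
  ∫ p, cexp (I * (inner ℝ p x : ℝ)) * A p

theorem expIntegral_eq_fourier (A : X → ℂ) (x : X) :
    expIntegral A x = 𝓕 A (-(2 * π)⁻¹ • x) := by
  rw [expIntegral, Real.fourier_eq']
  congr 1
  ext p
  rw [smul_eq_mul, inner_smul_right]
  congr 2
  push_cast
  field_simp

theorem invFourierDual_eq_expIntegral (a : StrongDual ℝ X → ℂ) (x : X) :
    invFourierDual a x = (((2 * π) ^ Module.finrank ℝ X)⁻¹ : ℝ) *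
      expIntegral (fun v => a (InnerProductSpace.toDual ℝ X v)) x := by
  rw [invFourierDual, dualVolume, expIntegral]
  congr 1
  exact (InnerProductSpace.toDual ℝ X).toHomeomorph.measurableEmbedding.integral_map _

theorem norm_expIntegral_le (A : X → ℂ) (x : X) : ‖expIntegral A x‖ ≤ ∫ p, ‖A p‖ := by
  refine (norm_integral_le_integral_norm _).trans_eq ?_
  congr 1; ext p
  rw [norm_mul, mul_comm I, norm_exp_ofReal_mul_I, one_mul]

theorem continuous_expIntegral {A : X → ℂ} (hA : Integrable A) : Continuous (expIntegral A) := by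
  refine continuous_of_dominated (bound := fun p => ‖A p‖) (fun x => ?_) (fun x => ?_) hA.norm ?_
  · exact (Continuous.aestronglyMeasurable (by fun_prop)).mul hA.1
  · refine .of_forall fun p => ?_
    rw [norm_mul, mul_comm I, norm_exp_ofReal_mul_I, one_mul]
  · exact .of_forall fun p => by fun_prop

theorem fourier_fderiv_apply {f : X → ℂ} (hf : Integrable f) (hd : Differentiable ℝ f)
    (hf' : Integrable (fderiv ℝ f)) (e w : X) :
    𝓕 (fun x => fderiv ℝ f x e) w = 2 * π * I * (inner ℝ w e : ℝ) * 𝓕 f w := by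
  rw [← Real.fourier_continuousLinearMap_apply hf', Real.fourier_fderiv hf hd hf']
  change -(2 * π * I) • ((-(inner ℝ w e : ℝ)) • 𝓕 f w) = _
  simp
  ring

theorem expIntegral_fderiv_apply {t : ℝ} (ht : (Module.finrank ℝ X : ℝ) < t) {f : X → ℂ}
    (hf : HasDerivGrowth (-t) f) (e x : X) :
    expIntegral (fun p => fderiv ℝ f p e) x = -(I * (inner ℝ x e : ℝ)) * expIntegral f x := by
  simp only [expIntegral_eq_fourier]
  rw [fourier_fderiv_apply (hf.integrable ht) (hf.1.differentiable (by simp))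
    (hf.integrable_fderiv ht), inner_smul_left]
  simp
  field_simp
  exact .inl trivial

/-- Take A = (1-Δ)a: each second derivative along an orthonormal basis becomes multiplication by
-⟨x,e_i⟩², and the growth class is stable under differentiation. -/
theorem exists_expIntegral_eq_one_add_norm_sq_mul {t : ℝ} (ht : (Module.finrank ℝ X : ℝ) < t)
    {a : X → ℂ} (ha : HasDerivGrowth (-t) a) :
    ∃ A : X → ℂ, HasDerivGrowth (-t) A ∧
      ∀ x, expIntegral A x = ((1 + ‖x‖ ^ 2 : ℝ) : ℂ) * expIntegral a x := by
  let e := stdOrthonormalBasis ℝ X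
  let D : Fin _ → X → ℂ := fun i p => fderiv ℝ (fun q => fderiv ℝ a q (e i)) p (e i)
  have hD : ∀ i, HasDerivGrowth (-t) (D i) := fun i => (ha.fderiv_apply _).fderiv_apply _
  refine ⟨a - ∑ i, D i, ha.sub (HasDerivGrowth.sum _ fun i _ => hD i), fun x => ?_⟩
  have hsq : (‖x‖ ^ 2 : ℝ) = ∑ i, (inner ℝ x (e i) : ℝ) ^ 2 := by
    rw [← e.sum_sq_norm_inner_left x]; simp
  have hint : ∀ f : X → ℂ, HasDerivGrowth (-t) f →
      Integrable (fun p => cexp (I * (inner ℝ p x : ℝ)) * f p) := fun f hf => by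
    refine (hf.integrable ht).bdd_mul (c := 1) (Continuous.aestronglyMeasurable (by fun_prop))
      (.of_forall fun p => ?_)
    rw [mul_comm I, norm_exp_ofReal_mul_I]
  have h1 : expIntegral (a - ∑ i, D i) x = expIntegral a x - ∑ i, expIntegral (D i) x := by
    simp only [expIntegral, Pi.sub_apply, Finset.sum_apply, mul_sub, Finset.mul_sum]
    rw [integral_sub (hint a ha) (integrable_finsetSum _ fun i _ => hint _ (hD i)),
      integral_finsetSum _ fun i _ => hint _ (hD i)]
  rw [h1, hsq]
  simp only [D, expIntegral_fderiv_apply ht (ha.fderiv_apply _), expIntegral_fderiv_apply ht ha]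
  push_cast
  rw [add_mul, one_mul, sub_eq_add_neg, ← Finset.sum_neg_distrib, Finset.sum_mul]
  congr 1
  refine Finset.sum_congr rfl fun i _ => ?_
  linear_combination -(inner ℝ x (e i) : ℂ) ^ 2 * expIntegral a x * I_sq

theorem exists_expIntegral_eq_one_add_norm_sq_pow_mul {t : ℝ}
    (ht : (Module.finrank ℝ X : ℝ) < t) {a : X → ℂ} (ha : HasDerivGrowth (-t) a) (M : ℕ) :
    ∃ A : X → ℂ, HasDerivGrowth (-t) A ∧
      ∀ x, expIntegral A x = ((1 + ‖x‖ ^ 2 : ℝ) : ℂ) ^ M * expIntegral a x := by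
  induction M with
  | zero => exact ⟨a, ha, by simp⟩
  | succ M ih =>
    obtain ⟨A, hA, h⟩ := ih
    obtain ⟨B, hB, h'⟩ := exists_expIntegral_eq_one_add_norm_sq_mul ht hA
    exact ⟨B, hB, fun x => by rw [h', h]; ring⟩

end ExpIntegral

/-! ### Chain and Leibniz estimates. -/

section DerivativeBounds

variable {V W F : Type*} [NormedAddCommGroup V] [NormedSpace ℝ V] [NormedAddCommGroup W]
  [NormedSpace ℝ W] [NormedAddCommGroup F] [NormedSpace ℝ F]

theorem norm_iteratedFDeriv_comp_clm_add_le {f : V → F} (hf : ContDiff ℝ ∞ f) (L : W →L[ℝ] V)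
    (w : V) (x : W) (j : ℕ) :
    ‖iteratedFDeriv ℝ j (fun x => f (L x + w)) x‖ ≤ ‖iteratedFDeriv ℝ j f (L x + w)‖ * ‖L‖ ^ j := by
  have h := L.iteratedFDeriv_comp_right (f := fun v => f (v + w)) (i := j) (n := ∞)
    (hf.comp (contDiff_id.add contDiff_const)) x (by exact_mod_cast le_top)
  rw [Function.comp_def] at h
  rw [h, iteratedFDeriv_comp_add_right]
  refine (ContinuousMultilinearMap.norm_compContinuousLinearMap_le _ _).trans_eq ?_
  simp

/-- The binomial coefficients sum to 2^j ≤ 2^k. Bounding all orders up to k at once lets the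
estimate be iterated on a triple product. -/
theorem norm_iteratedFDeriv_mul_le_of_le {f g : V → ℂ} (hf : ContDiff ℝ ∞ f)
    (hg : ContDiff ℝ ∞ g) {x : V} {k : ℕ} {α β : ℝ}
    (hfα : ∀ i ≤ k, ‖iteratedFDeriv ℝ i f x‖ ≤ α) (hgβ : ∀ i ≤ k, ‖iteratedFDeriv ℝ i g x‖ ≤ β) :
    ∀ j ≤ k, ‖iteratedFDeriv ℝ j (fun x => f x * g x) x‖ ≤ 2 ^ k * (α * β) := by
  intro j hj
  have hα : 0 ≤ α := (norm_nonneg _).trans (hfα 0 (zero_le))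
  have hβ : 0 ≤ β := (norm_nonneg _).trans (hgβ 0 (zero_le))
  calc ‖iteratedFDeriv ℝ j (fun x => f x * g x) x‖
      ≤ ∑ i ∈ Finset.range (j + 1), (j.choose i : ℝ) * ‖iteratedFDeriv ℝ i f x‖ *
          ‖iteratedFDeriv ℝ (j - i) g x‖ :=
        norm_iteratedFDeriv_mul_le hf hg x (by exact_mod_cast le_top)
    _ ≤ ∑ i ∈ Finset.range (j + 1), (j.choose i : ℝ) * (α * β) := by
        refine Finset.sum_le_sum fun i hi => ?_
        rw [mul_assoc]
        have hi' : i ≤ j := Nat.lt_succ_iff.1 (Finset.mem_range.1 hi)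
        gcongr
        · exact hfα i (hi'.trans hj)
        · exact hgβ _ ((Nat.sub_le j i).trans hj)
    _ = 2 ^ j * (α * β) := by
        rw [← Finset.sum_mul]
        congr 1
        exact_mod_cast Nat.sum_range_choose j
    _ ≤ 2 ^ k * (α * β) := by gcongr; exact one_le_two

end DerivativeBounds

/-! ### Decay of all derivatives of a negative power of the bracket. -/

section JapaneseBracketDecay

variable {X : Type*} [NormedAddCommGroup X] [InnerProductSpace ℝ X]

/-- The weight `(1 + ‖x‖ ^ 2) ^ (-M)`, as a complex-valued function. -/
noncomputable def bracketWeight (M : ℕ) (x : X) : ℂ := (((1 + ‖x‖ ^ 2) ^ (-(M : ℝ)) : ℝ) : ℂ)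

theorem contDiff_bracketWeight (M : ℕ) : ContDiff ℝ ∞ (bracketWeight M : X → ℂ) :=
  Complex.ofRealCLM.contDiff.comp (Function.hasTemperateGrowth_one_add_norm_sq_rpow X _).1

theorem exists_norm_iteratedFDerivWithin_rpow_le (r : ℝ) (K : ℕ) :
    ∃ C : ℝ, 0 ≤ C ∧ ∀ i ≤ K, ∀ u : ℝ, 1 ≤ u →
      ‖iteratedFDerivWithin ℝ i (fun v : ℝ => v ^ r) (Set.Ioi 0) u‖ ≤ C * u ^ r := by
  refine ⟨∑ k ∈ Finset.range (K + 1), ‖Polynomial.eval r (descPochhammer ℝ k)‖, by positivity,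
    fun i hi u hu => ?_⟩
  have hu0 : u ∈ Set.Ioi (0 : ℝ) := zero_lt_one.trans_le hu
  rw [norm_iteratedFDerivWithin_eq_norm_iteratedDerivWithin,
    iteratedDerivWithin_eq_iteratedDeriv isOpen_Ioi.uniqueDiffOn
      (Real.contDiffAt_rpow_const (.inl hu0.ne')) hu0, iteratedDeriv_eq_iterate,
    Real.iter_deriv_rpow_const, norm_mul]
  gcongr
  · exact Finset.single_le_sum (f := fun k => ‖Polynomial.eval r (descPochhammer ℝ k)‖)
      (fun _ _ => norm_nonneg _) (Finset.mem_range.2 (by omega))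
  · rw [Real.norm_of_nonneg (by positivity)]
    exact Real.rpow_le_rpow_of_exponent_le hu (by simp)

/-- In the Faà di Bruno estimate, derivatives up to order K cost at most a power (1+|x|)^(κK) with κ
independent of M. Choosing 2M ≥ N + κK absorbs it. -/
theorem exists_norm_iteratedFDeriv_bracketWeight_le (N : ℝ) (K : ℕ) :
    ∃ (M : ℕ) (C : ℝ), 0 ≤ C ∧ ∀ j ≤ K, ∀ x : X,
      ‖iteratedFDeriv ℝ j (bracketWeight M) x‖ ≤ C * (1 + ‖x‖) ^ (-N) := by
  have hgrow : (fun x : X => 1 + ‖x‖ ^ 2).HasTemperateGrowth := by fun_prop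
  obtain ⟨κ, C₀, hC₀, h₀⟩ := hgrow.norm_iteratedFDeriv_le_uniform K
  obtain ⟨M, hM⟩ := exists_nat_ge (max 1 ((N + κ * K) / 2))
  have hM1 : (1 : ℝ) ≤ M := le_sup_left.trans hM
  have hM2 : (N + κ * K) / 2 ≤ M := le_sup_right.trans hM
  obtain ⟨C₁, hC₁, h₁⟩ := exists_norm_iteratedFDerivWithin_rpow_le (-(M : ℝ)) K
  refine ⟨M, K.factorial * (C₁ * 2 ^ (M : ℝ)) * (1 + C₀) ^ K, by positivity, fun j hj x => ?_⟩
  have hx := norm_nonneg x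
  -- Using 1 + C₀ in place of C₀ keeps the base at least 1, so its powers increase with the order.
  have hD1 : 1 ≤ (1 + C₀) * (1 + ‖x‖) ^ κ :=
    one_le_mul_of_one_le_of_one_le (by linarith) (one_le_pow₀ (by linarith))
  have h2 : ‖iteratedFDeriv ℝ j (fun x : X => (1 + ‖x‖ ^ 2) ^ (-(M : ℝ))) x‖ ≤
      j.factorial * (C₁ * (1 + ‖x‖ ^ 2) ^ (-(M : ℝ))) * ((1 + C₀) * (1 + ‖x‖) ^ κ) ^ j := by
    refine norm_iteratedFDeriv_comp_le' (g := fun v : ℝ => v ^ (-(M : ℝ))) (t := Set.Ioi 0)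
      (f := fun x : X => 1 + ‖x‖ ^ 2) (N := ∞) ?_ isOpen_Ioi.uniqueDiffOn ?_ hgrow.1
      (by exact_mod_cast le_top) x (fun i hi => ?_) (fun i hi hij => ?_)
    · rintro _ ⟨y, rfl⟩
      exact Set.mem_Ioi.2 (by positivity)
    · exact contDiffOn_fun_id.rpow_const_of_ne fun u hu => (Set.mem_Ioi.1 hu).ne'
    · exact h₁ i (hi.trans hj) _ (by nlinarith)
    · calc _ ≤ C₀ * (1 + ‖x‖) ^ κ := h₀ i (hij.trans hj) x
        _ ≤ (1 + C₀) * (1 + ‖x‖) ^ κ := by gcongr; linarith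
        _ ≤ _ := le_self_pow₀ hD1 (by omega)
  have h3 : (1 + ‖x‖ ^ 2) ^ (-(M : ℝ)) ≤ 2 ^ (M : ℝ) * (1 + ‖x‖) ^ (-(2 * M : ℝ)) := by
    have := rpow_neg_one_add_norm_sq_le (r := 2 * M) x (by linarith)
    convert this using 2 <;> ring_nf
  have h4 : iteratedFDeriv ℝ j (bracketWeight M : X → ℂ) x =
      Complex.ofRealCLM.compContinuousMultilinearMap
        (iteratedFDeriv ℝ j (fun x : X => (1 + ‖x‖ ^ 2) ^ (-(M : ℝ))) x) :=
    Complex.ofRealCLM.iteratedFDeriv_comp_left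
      (Function.hasTemperateGrowth_one_add_norm_sq_rpow X _).1.contDiffAt
      (by exact_mod_cast le_top)
  calc ‖iteratedFDeriv ℝ j (bracketWeight M) x‖
      ≤ ‖iteratedFDeriv ℝ j (fun x : X => (1 + ‖x‖ ^ 2) ^ (-(M : ℝ))) x‖ := by
        rw [h4]
        refine (ContinuousLinearMap.norm_compContinuousMultilinearMap_le _ _).trans ?_
        rw [Complex.ofRealCLM_norm, one_mul]
    _ ≤ j.factorial * (C₁ * (1 + ‖x‖ ^ 2) ^ (-(M : ℝ))) * ((1 + C₀) * (1 + ‖x‖) ^ κ) ^ j := h2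
    _ ≤ K.factorial * (C₁ * (2 ^ (M : ℝ) * (1 + ‖x‖) ^ (-(2 * M : ℝ)))) *
          ((1 + C₀) * (1 + ‖x‖) ^ κ) ^ K := by gcongr
    _ = K.factorial * (C₁ * 2 ^ (M : ℝ)) * (1 + C₀) ^ K *
          ((1 + ‖x‖) ^ (-(2 * M : ℝ)) * ((1 + ‖x‖) ^ κ) ^ K) := by rw [mul_pow]; ring
    _ ≤ K.factorial * (C₁ * 2 ^ (M : ℝ)) * (1 + C₀) ^ K * (1 + ‖x‖) ^ (-N) := by
        gcongr
        rw [← pow_mul, ← Real.rpow_natCast, ← Real.rpow_add (by positivity)]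
        exact Real.rpow_le_rpow_of_exponent_le (by linarith) (by push_cast; linarith)

end JapaneseBracketDecay

/-! ### Smoothness gives Fourier decay, uniformly under translation. -/

section FourierDecay

open FourierTransform

variable {X : Type*} [NormedAddCommGroup X] [InnerProductSpace ℝ X] [FiniteDimensional ℝ X]
  [MeasurableSpace X] [BorelSpace X]

/-- The hypothesis bounds the L¹ norms of the derivatives, and translation invariance removes z from
these norms. Hence C depends neither on Φ nor on z. -/
theorem exists_norm_fourier_le_rpow_neg {d : ℝ} (hd : (Module.finrank ℝ X : ℝ) < d) (k : ℕ) :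
    ∃ C : ℝ, 0 ≤ C ∧ ∀ (Φ : X → ℂ) (z : X) (B : ℝ), ContDiff ℝ ∞ Φ →
      (∀ j ≤ k, ∀ x, ‖iteratedFDeriv ℝ j Φ x‖ ≤ B * (1 + ‖x + z‖) ^ (-d)) →
      ∀ w, ‖𝓕 Φ w‖ ≤ C * B * (1 + ‖w‖) ^ (-(k : ℝ)) := by
  set I : ℝ := ∫ x : X, (1 + ‖x‖) ^ (-d) with hI
  have hI0 : 0 ≤ I := integral_nonneg fun x => by positivity
  refine ⟨2 ^ (k - 1) * (I + 2 ^ k * ((k + 1) * I)), by positivity, fun Φ z B hΦ hB w => ?_⟩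
  have hint : Integrable (fun x : X => B * (1 + ‖x + z‖) ^ (-d)) :=
    ((integrable_one_add_norm hd).comp_add_right z).const_mul B
  have hΦint : ∀ j ≤ k, Integrable (fun x => ‖iteratedFDeriv ℝ j Φ x‖) := fun j hj =>
    hint.mono' (hΦ.continuous_iteratedFDeriv (m := j) (by exact_mod_cast le_top)).norm.aestronglyMeasurable
      (.of_forall fun x => by simpa using hB j hj x)
  have hΦle : ∀ j ≤ k, ∫ x, ‖iteratedFDeriv ℝ j Φ x‖ ≤ B * I := fun j hj => by
    calc _ ≤ ∫ x : X, B * (1 + ‖x + z‖) ^ (-d) := integral_mono (hΦint j hj) hint (hB j hj)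
      _ = B * I := by
        rw [integral_const_mul, integral_add_right_eq_self (fun x : X => (1 + ‖x‖) ^ (-d)) z]
  have h0 : ‖𝓕 Φ w‖ ≤ B * I := by
    refine (VectorFourier.norm_fourierIntegral_le_integral_norm _ _ _ _ _).trans ?_
    simpa using hΦle 0 zero_le
  have hk := Real.pow_mul_norm_iteratedFDeriv_fourier_le (K := 0) (N := k) (k := 0) (n := k)
    (hΦ.of_le (by exact_mod_cast le_top)) (fun i j hi hj => by
      have hi0 : i = 0 := by simpa using hi
      subst hi0
      simpa using hΦint j (by exact_mod_cast hj)) le_rfl le_rfl w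
  have hk' : ‖w‖ ^ k * ‖𝓕 Φ w‖ ≤ 2 ^ k * ((k + 1) * (B * I)) := by
    simp only [norm_iteratedFDeriv_zero, pow_zero, one_mul, Nat.cast_zero, mul_zero, zero_add,
      Finset.range_one, Finset.singleton_product, Finset.sum_map, Function.Embedding.coeFn_mk] at hk
    refine hk.trans ?_
    gcongr
    refine (Finset.sum_le_card_nsmul _ _ (B * I) fun j hj => ?_).trans_eq (by simp)
    exact hΦle j (Nat.lt_succ_iff.1 (Finset.mem_range.1 hj))
  rw [Real.rpow_neg (by positivity), Real.rpow_natCast, ← div_eq_mul_inv,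
    le_div_iff₀ (by positivity)]
  calc ‖𝓕 Φ w‖ * (1 + ‖w‖) ^ k ≤ ‖𝓕 Φ w‖ * (2 ^ (k - 1) * (1 ^ k + ‖w‖ ^ k)) := by
        gcongr
        exact add_pow_le zero_le_one (norm_nonneg w) k
    _ = 2 ^ (k - 1) * (‖𝓕 Φ w‖ + ‖w‖ ^ k * ‖𝓕 Φ w‖) := by rw [one_pow]; ring
    _ ≤ 2 ^ (k - 1) * (B * I + 2 ^ k * ((k + 1) * (B * I))) := by gcongr
    _ = _ := by ring

end FourierDecay

/-! ### Peetre-type inequalities in abstract form. -/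

section WeightInequalities

/-- The power s of vu is shared equally between a and y, and the spare power d of v pays for z. It
is used with a = 1+|x|, u = 1+|x-y|, v = 1+|(1-τ)x+τy|, and y standing for 1+|y|. -/
theorem rpow_mul_rpow_neg_le_of_le_mul {a u v y z r s d : ℝ} (ha : 0 < a) (hu : 0 < u) (hv : 0 < v)
    (hy : 0 < y) (hz : 0 < z) (hr : 0 < r) (hs : 0 ≤ s) (hd : 0 ≤ d) (hav : a ≤ r * (v * u))
    (hyv : y ≤ r * (v * u)) (hzv : z ≤ r * v) :
    a ^ (s / 2) * (u ^ (-s) * v ^ (-(s + d))) ≤ r ^ (s + d) * (y ^ (-(s / 2)) * z ^ (-d)) := by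
  have hs2 : 0 ≤ s / 2 := by positivity
  have key : a ^ (s / 2) * y ^ (s / 2) * z ^ d ≤ r ^ (s + d) * (u ^ s * v ^ (s + d)) := by
    calc a ^ (s / 2) * y ^ (s / 2) * z ^ d
        ≤ (r * (v * u)) ^ (s / 2) * (r * (v * u)) ^ (s / 2) * (r * v) ^ d := by gcongr
      _ = (r * (v * u)) ^ s * (r * v) ^ d := by
          rw [← Real.rpow_add (by positivity), add_halves]
      _ = r ^ (s + d) * (u ^ s * v ^ (s + d)) := by
          rw [Real.mul_rpow hr.le (by positivity), Real.mul_rpow hv.le hu.le,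
            Real.mul_rpow hr.le hv.le, Real.rpow_add hr, Real.rpow_add hv]
          ring
  simp only [Real.rpow_neg hu.le, Real.rpow_neg hv.le, Real.rpow_neg hy.le, Real.rpow_neg hz.le]
  rw [← mul_inv, ← mul_inv, ← div_eq_mul_inv, ← div_eq_mul_inv, div_le_div_iff₀ (by positivity)
    (by positivity), ← mul_assoc]
  exact key

theorem rpow_neg_mul_rpow_neg_le_of_le_mul {p u w z r t d : ℝ} (hp : 0 < p) (hu : 0 < u)
    (hw : 0 < w) (hz : 0 < z) (hr : 0 < r) (ht : 0 ≤ t) (hd : 0 ≤ d) (hwp : w ≤ r * (p * u))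
    (hzu : z ≤ r * u) :
    p ^ (-t) * u ^ (-(t + d)) ≤ r ^ (t + d) * (w ^ (-t) * z ^ (-d)) := by
  have key : w ^ t * z ^ d ≤ r ^ (t + d) * (p ^ t * u ^ (t + d)) := by
    calc w ^ t * z ^ d ≤ (r * (p * u)) ^ t * (r * u) ^ d := by gcongr
      _ = r ^ (t + d) * (p ^ t * u ^ (t + d)) := by
          rw [Real.mul_rpow hr.le (by positivity), Real.mul_rpow hp.le hu.le,
            Real.mul_rpow hr.le hu.le, Real.rpow_add hr, Real.rpow_add hu]
          ring
  simp only [Real.rpow_neg hu.le, Real.rpow_neg hp.le, Real.rpow_neg hw.le, Real.rpow_neg hz.le]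
  rw [← mul_inv, ← mul_inv, ← div_eq_mul_inv, inv_eq_one_div,
    div_le_div_iff₀ (by positivity) (by positivity), one_mul]
  exact key

end WeightInequalities

/-! ### Estimates on a slice of the kernel and on its Fourier transform. -/

section Slices

open FourierTransform Real Complex
open scoped RealInnerProductSpace

variable {X : Type*} [NormedAddCommGroup X] [InnerProductSpace ℝ X]

/-- `ρ` is the inverse of `1 - τ`, and `τ`, `1 - τ` and `ρ` are bounded by `R`. -/
structure IsBoundedResolvent (R : ℝ) (τ ρ : X →L[ℝ] X) : Prop where
  norm_le : ‖τ‖ ≤ R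
  norm_one_sub_le : ‖1 - τ‖ ≤ R
  norm_inv_le : ‖ρ‖ ≤ R
  inv_mul : ρ * (1 - τ) = 1
  mul_inv : (1 - τ) * ρ = 1

namespace IsBoundedResolvent

variable {R : ℝ} {τ ρ : X →L[ℝ] X}

theorem inv_apply (h : IsBoundedResolvent R τ ρ) (x : X) : ρ ((1 - τ) x) = x :=
  congrArg (fun L : X →L[ℝ] X => L x) h.inv_mul

theorem apply_inv (h : IsBoundedResolvent R τ ρ) (x : X) : (1 - τ) (ρ x) = x :=
  congrArg (fun L : X →L[ℝ] X => L x) h.mul_inv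

theorem adjoint_inv_adjoint_apply [CompleteSpace X] (h : IsBoundedResolvent R τ ρ) (p : X) :
    ContinuousLinearMap.adjoint ρ (ContinuousLinearMap.adjoint (1 - τ) p) = p :=
  ext_inner_right ℝ fun x => by
    rw [ContinuousLinearMap.adjoint_inner_left, ContinuousLinearMap.adjoint_inner_left, h.apply_inv]

theorem one_add_norm_left_le (h : IsBoundedResolvent R τ ρ) (x y : X) :
    1 + ‖x‖ ≤ (1 + R) * ((1 + ‖(1 - τ) x + τ y‖) * (1 + ‖x - y‖)) := by
  have h1 : x = ((1 - τ) x + τ y) + τ (x - y) := by simp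
  calc 1 + ‖x‖ = 1 + ‖((1 - τ) x + τ y) + τ (x - y)‖ := by rw [← h1]
    _ ≤ (1 + ‖(1 - τ) x + τ y‖) * ((1 + ‖τ‖) * (1 + ‖x - y‖)) :=
        (one_add_norm_add_le _ _).trans (by gcongr; exact one_add_norm_apply_le _ _)
    _ ≤ (1 + ‖(1 - τ) x + τ y‖) * ((1 + R) * (1 + ‖x - y‖)) := by gcongr; exact h.norm_le
    _ = _ := by ring

theorem one_add_norm_right_le (h : IsBoundedResolvent R τ ρ) (x y : X) :
    1 + ‖y‖ ≤ (1 + R) * ((1 + ‖(1 - τ) x + τ y‖) * (1 + ‖x - y‖)) := by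
  have h1 : y = ((1 - τ) x + τ y) + (1 - τ) (-(x - y)) := by simp; abel
  calc 1 + ‖y‖ = 1 + ‖((1 - τ) x + τ y) + (1 - τ) (-(x - y))‖ := by rw [← h1]
    _ ≤ (1 + ‖(1 - τ) x + τ y‖) * ((1 + ‖1 - τ‖) * (1 + ‖-(x - y)‖)) :=
        (one_add_norm_add_le _ _).trans (by gcongr; exact one_add_norm_apply_le _ _)
    _ ≤ (1 + ‖(1 - τ) x + τ y‖) * ((1 + R) * (1 + ‖x - y‖)) := by
        rw [norm_neg]; gcongr; exact h.norm_one_sub_le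
    _ = _ := by ring

theorem one_add_norm_add_inv_le (h : IsBoundedResolvent R τ ρ) (x y : X) :
    1 + ‖x + ρ (τ y)‖ ≤ (1 + R) * (1 + ‖(1 - τ) x + τ y‖) := by
  have h1 : x + ρ (τ y) = ρ ((1 - τ) x + τ y) := by rw [map_add, h.inv_apply]
  rw [h1]
  refine (one_add_norm_apply_le _ _).trans ?_
  gcongr
  exact h.norm_inv_le

end IsBoundedResolvent

/-- The smooth factor of the kernel slice `x ↦ c x * cordesKernel a b τ x y`. -/
noncomputable def sliceAmplitude (b c : X → ℂ) (M : ℕ) (τ : X →L[ℝ] X) (y x : X) : ℂ :=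
  c x * (b (x - y) * bracketWeight M ((1 - τ) x + τ y))

variable {b c : X → ℂ} {M : ℕ}

theorem contDiff_sliceAmplitude (hb : ContDiff ℝ ∞ b) (hc : ContDiff ℝ ∞ c) (τ : X →L[ℝ] X)
    (y : X) : ContDiff ℝ ∞ (sliceAmplitude b c M τ y) :=
  hc.mul ((hb.comp (contDiff_id.sub contDiff_const)).mul
    ((contDiff_bracketWeight M).comp ((1 - τ).contDiff.add contDiff_const)))

/-- Half of the order s cancels the growth of c, the other half becomes decay in y, and the extra
order d of the bracket becomes decay in x around -ρτy. -/
theorem exists_norm_iteratedFDeriv_sliceAmplitude_le {s d C' R : ℝ} (hs : 0 ≤ s) (hd : 0 ≤ d)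
    (hR : 0 ≤ R) (hb : HasDerivGrowth (-s) b) (hc : HasDerivGrowth (s / 2) c) (k : ℕ)
    (hM : ∀ j ≤ k, ∀ x : X,
      ‖iteratedFDeriv ℝ j (bracketWeight M) x‖ ≤ C' * (1 + ‖x‖) ^ (-(s + d))) :
    ∃ C : ℝ, 0 ≤ C ∧ ∀ (τ ρ : X →L[ℝ] X), IsBoundedResolvent R τ ρ → ∀ y, ∀ j ≤ k, ∀ x,
      ‖iteratedFDeriv ℝ j (sliceAmplitude b c M τ y) x‖ ≤
        C * (1 + ‖y‖) ^ (-(s / 2)) * (1 + ‖x + ρ (τ y)‖) ^ (-d) := by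
  obtain ⟨B, hB, hbB⟩ := hb.exists_uniform_bound k
  obtain ⟨D, hD, hcD⟩ := hc.exists_uniform_bound k
  have hC' : 0 ≤ C' := by
    have := (norm_nonneg _).trans (hM 0 zero_le 0)
    simpa using this
  refine ⟨2 ^ k * (D * (2 ^ k * (B * (C' * (1 + R) ^ k)))) * (1 + R) ^ (s + d), by positivity,
    fun τ ρ h y j hj x => ?_⟩
  have hb' : ContDiff ℝ ∞ fun x => b (x - y) := hb.1.comp (contDiff_id.sub contDiff_const)
  have hq' : ContDiff ℝ ∞ fun x => (bracketWeight M ((1 - τ) x + τ y) : ℂ) :=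
    (contDiff_bracketWeight M).comp ((1 - τ).contDiff.add contDiff_const)
  have h1 : ∀ i ≤ k, ‖iteratedFDeriv ℝ i (fun x => b (x - y)) x‖ ≤ B * (1 + ‖x - y‖) ^ (-s) :=
    fun i hi => by
      rw [iteratedFDeriv_comp_sub]
      exact hbB i hi _
  have h2 : ∀ i ≤ k, ‖iteratedFDeriv ℝ i (fun x => (bracketWeight M ((1 - τ) x + τ y) : ℂ)) x‖ ≤
      C' * (1 + ‖(1 - τ) x + τ y‖) ^ (-(s + d)) * (1 + R) ^ k := fun i hi => by
    refine (norm_iteratedFDeriv_comp_clm_add_le (contDiff_bracketWeight M) _ _ _ _).trans ?_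
    gcongr
    · exact hM i hi _
    · calc ‖1 - τ‖ ^ i ≤ (1 + R) ^ i := by gcongr; linarith [h.norm_one_sub_le]
        _ ≤ (1 + R) ^ k := pow_le_pow_right₀ (by linarith) hi
  have h3 := norm_iteratedFDeriv_mul_le_of_le hb' hq' h1 h2
  have h4 := norm_iteratedFDeriv_mul_le_of_le hc.1 (hb'.mul hq') (fun i hi => hcD i hi x) h3 j hj
  refine h4.trans ?_
  have h5 := rpow_mul_rpow_neg_le_of_le_mul (a := 1 + ‖x‖) (u := 1 + ‖x - y‖)
    (v := 1 + ‖(1 - τ) x + τ y‖) (y := 1 + ‖y‖) (z := 1 + ‖x + ρ (τ y)‖) (r := 1 + R) (s := s)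
    (d := d) (by positivity) (by positivity) (by positivity) (by positivity) (by positivity)
    (by positivity) hs hd (h.one_add_norm_left_le x y) (h.one_add_norm_right_le x y)
    (h.one_add_norm_add_inv_le x y)
  calc _ = 2 ^ k * (D * (2 ^ k * (B * (C' * (1 + R) ^ k)))) * ((1 + ‖x‖) ^ (s / 2) *
        ((1 + ‖x - y‖) ^ (-s) * (1 + ‖(1 - τ) x + τ y‖) ^ (-(s + d)))) := by ring
    _ ≤ 2 ^ k * (D * (2 ^ k * (B * (C' * (1 + R) ^ k)))) * ((1 + R) ^ (s + d) *
        ((1 + ‖y‖) ^ (-(s / 2)) * (1 + ‖x + ρ (τ y)‖) ^ (-d))) := by gcongr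
    _ = _ := by ring

variable [FiniteDimensional ℝ X] [MeasurableSpace X] [BorelSpace X]

/-- Each plane wave in p translates the transform of Φ by S p, where `hS` says that S is the adjoint
of L divided by 2π. Fubini applies because Φ and A are integrable. -/
theorem fourier_mul_expIntegral_comp {Φ A : X → ℂ} (hΦ : Integrable Φ) (hA : Integrable A)
    (L S : X →L[ℝ] X) (hS : ∀ p x, (inner ℝ p (L x) : ℝ) = 2 * π * inner ℝ x (S p)) (z w : X) :
    𝓕 (fun x => Φ x * expIntegral A (L x + z)) w =
      ∫ p, cexp (I * (inner ℝ p z : ℝ)) * A p * 𝓕 Φ (w - S p) := by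
  have hphase : Integrable (fun q : X × X =>
      cexp (((-2 * π * inner ℝ q.1 w + inner ℝ q.2 (L q.1 + z) : ℝ) : ℂ) * I) *
        (Φ q.1 * A q.2)) (volume.prod volume) := by
    refine (hΦ.mul_prod hA).bdd_mul (c := 1) (Continuous.aestronglyMeasurable (by fun_prop))
      (.of_forall fun q => ?_)
    rw [norm_exp_ofReal_mul_I]
  simp only [Real.fourier_eq', expIntegral, smul_eq_mul]
  calc _ = ∫ x, ∫ p, cexp (((-2 * π * inner ℝ x w + inner ℝ p (L x + z) : ℝ) : ℂ) * I) *
        (Φ x * A p) := by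
        refine integral_congr_ae (.of_forall fun x => ?_)
        dsimp only
        rw [← mul_assoc, ← integral_const_mul]
        refine integral_congr_ae (.of_forall fun p => ?_)
        dsimp only
        rw [ofReal_add, add_mul, Complex.exp_add, mul_comm I]
        ring
    _ = ∫ p, ∫ x, cexp (((-2 * π * inner ℝ x w + inner ℝ p (L x + z) : ℝ) : ℂ) * I) *
        (Φ x * A p) := integral_integral_swap hphase
    _ = _ := by
        refine integral_congr_ae (.of_forall fun p => ?_)
        dsimp only
        rw [← integral_const_mul]
        refine integral_congr_ae (.of_forall fun x => ?_)
        dsimp only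
        have : (-2 * π * inner ℝ x w + inner ℝ p (L x + z) : ℝ) =
            inner ℝ p z + -2 * π * inner ℝ x (w - S p) := by
          rw [inner_add_right, hS, inner_sub_right]; ring
        rw [this, ofReal_add, add_mul, Complex.exp_add, mul_comm I]
        ring

/-- Of the decay t+d of Ψ, the order t combines with that of A to give decay in w. The order d is
left for integrability in p: since S' w - p = S'(w - S p), the bound is a translate of one fixed
integrable weight. -/
theorem norm_integral_phase_mul_comp_le {t d R B C : ℝ} (ht : 0 ≤ t)
    (hd : (Module.finrank ℝ X : ℝ) < d) (hR : 0 ≤ R) (hB : 0 ≤ B) (hC : 0 ≤ C) {A Ψ θ : X → ℂ}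
    (hθ : ∀ p, ‖θ p‖ ≤ 1)
    (hA : ∀ p, ‖A p‖ ≤ C * (1 + ‖p‖) ^ (-t)) (hΨ : ∀ ξ, ‖Ψ ξ‖ ≤ B * (1 + ‖ξ‖) ^ (-(t + d)))
    {S S' : X →L[ℝ] X} (hS : ‖S‖ ≤ R) (hS' : ‖S'‖ ≤ R) (hinv : ∀ p, S' (S p) = p) (w : X) :
    ‖∫ p, θ p * A p * Ψ (w - S p)‖ ≤
      C * B * (1 + R) ^ (t + d) * (∫ p : X, (1 + ‖p‖) ^ (-d)) * (1 + ‖w‖) ^ (-t) := by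
  have hd0 : 0 ≤ d := (Nat.cast_nonneg _).trans hd.le
  have hint : Integrable fun p : X => (1 + ‖S' w - p‖) ^ (-d) :=
    (integrable_one_add_norm hd).comp_sub_left (S' w)
  have hle : ∀ p, ‖θ p * A p * Ψ (w - S p)‖ ≤
      C * B * (1 + R) ^ (t + d) * (1 + ‖w‖) ^ (-t) * (1 + ‖S' w - p‖) ^ (-d) := fun p => by
    have hw : 1 + ‖w‖ ≤ (1 + R) * ((1 + ‖p‖) * (1 + ‖w - S p‖)) := by
      calc 1 + ‖w‖ = 1 + ‖S p + (w - S p)‖ := by simp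
        _ ≤ ((1 + ‖S‖) * (1 + ‖p‖)) * (1 + ‖w - S p‖) :=
          (one_add_norm_add_le _ _).trans (by gcongr; exact one_add_norm_apply_le _ _)
        _ ≤ ((1 + R) * (1 + ‖p‖)) * (1 + ‖w - S p‖) := by gcongr
        _ = _ := by ring
    have hz : 1 + ‖S' w - p‖ ≤ (1 + R) * (1 + ‖w - S p‖) := by
      have : S' w - p = S' (w - S p) := by rw [map_sub, hinv]
      rw [this]
      refine (one_add_norm_apply_le _ _).trans ?_
      gcongr
    have key := rpow_neg_mul_rpow_neg_le_of_le_mul (p := 1 + ‖p‖) (u := 1 + ‖w - S p‖)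
      (w := 1 + ‖w‖) (z := 1 + ‖S' w - p‖) (r := 1 + R) (t := t) (d := d) (by positivity)
      (by positivity) (by positivity) (by positivity) (by positivity) ht hd0 hw hz
    rw [norm_mul, norm_mul]
    calc ‖θ p‖ * ‖A p‖ * ‖Ψ (w - S p)‖
        ≤ 1 * (C * (1 + ‖p‖) ^ (-t)) * (B * (1 + ‖w - S p‖) ^ (-(t + d))) := by
          gcongr
          exacts [hθ p, hA p, hΨ _]
      _ = C * B * ((1 + ‖p‖) ^ (-t) * (1 + ‖w - S p‖) ^ (-(t + d))) := by ring
      _ ≤ C * B * ((1 + R) ^ (t + d) * ((1 + ‖w‖) ^ (-t) * (1 + ‖S' w - p‖) ^ (-d))) := by gcongr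
      _ = _ := by ring
  refine (norm_integral_le_of_norm_le (hint.const_mul _) (.of_forall hle)).trans_eq ?_
  rw [integral_const_mul, integral_sub_left_eq_self (fun x : X => (1 + ‖x‖) ^ (-d)) volume (S' w)]
  ring

/-- The slice `x ↦ c x * cordesKernel a b τ x y`, up to the normalization of the Fourier transform,
when `expIntegral A` is the product of `(1 + ‖x‖ ^ 2) ^ M` and the Fourier transform of `a`. -/
noncomputable def kernelSlice (A b c : X → ℂ) (M : ℕ) (τ : X →L[ℝ] X) (y x : X) : ℂ :=
  sliceAmplitude b c M τ y x * expIntegral A ((1 - τ) x + τ y)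

/-- Taking k ≥ t+d derivatives of the amplitude gives its transform the decay t+d that the frequency
integral requires. -/
theorem exists_norm_kernelSlice_le {s t d R C' : ℝ} (hs : 0 ≤ s)
    (ht : (Module.finrank ℝ X : ℝ) < t) (hd : (Module.finrank ℝ X : ℝ) < d) (hR : 0 ≤ R)
    {A : X → ℂ} (hA : HasDerivGrowth (-t) A) (hb : HasDerivGrowth (-s) b)
    (hc : HasDerivGrowth (s / 2) c) {k : ℕ} (hk : t + d ≤ k)
    (hM : ∀ j ≤ k, ∀ x : X,
      ‖iteratedFDeriv ℝ j (bracketWeight M) x‖ ≤ C' * (1 + ‖x‖) ^ (-(s + d))) :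
    ∃ C : ℝ, 0 ≤ C ∧ ∀ (τ ρ : X →L[ℝ] X), IsBoundedResolvent R τ ρ → ∀ y,
      (∀ x, ‖kernelSlice A b c M τ y x‖ ≤
        C * (1 + ‖y‖) ^ (-(s / 2)) * (1 + ‖x + ρ (τ y)‖) ^ (-d)) ∧
      ∀ w, ‖𝓕 (kernelSlice A b c M τ y) w‖ ≤
        C * (1 + ‖y‖) ^ (-(s / 2)) * (1 + ‖w‖) ^ (-t) := by
  have := FiniteDimensional.complete ℝ X
  have ht0 : 0 ≤ t := (Nat.cast_nonneg _).trans ht.le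
  have hd0 : 0 ≤ d := (Nat.cast_nonneg _).trans hd.le
  obtain ⟨C₁, hC₁, h₁⟩ := exists_norm_iteratedFDeriv_sliceAmplitude_le hs hd0 hR hb hc k hM
  obtain ⟨C₂, hC₂, h₂⟩ := exists_norm_fourier_le_rpow_neg (X := X) hd k
  obtain ⟨C₃, hC₃, h₃⟩ := hA.exists_norm_le
  have hAi : Integrable A := hA.integrable ht
  set J : ℝ := ∫ p, ‖A p‖
  have hJ : 0 ≤ J := integral_nonneg fun p => norm_nonneg _
  set J' : ℝ := ∫ p : X, (1 + ‖p‖) ^ (-d)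
  have hJ' : 0 ≤ J' := integral_nonneg fun p => by positivity
  -- A common bound for S and its inverse S', which carry the factors (2π)⁻¹ and 2π.
  set R' : ℝ := 2 * π * R
  have hπ : 1 ≤ 2 * π := by linarith [Real.pi_gt_three]
  have hR' : 0 ≤ R' := by positivity
  refine ⟨C₁ * J + C₃ * (C₂ * C₁) * (1 + R') ^ (t + d) * J', by positivity,
    fun τ ρ h y => ⟨fun x => ?_, fun w => ?_⟩⟩
  · have hΦ := h₁ τ ρ h y 0 zero_le x
    rw [norm_iteratedFDeriv_zero] at hΦ
    rw [kernelSlice, norm_mul]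
    calc _ ≤ C₁ * (1 + ‖y‖) ^ (-(s / 2)) * (1 + ‖x + ρ (τ y)‖) ^ (-d) * J := by
          gcongr
          exact norm_expIntegral_le _ _
      _ = C₁ * J * (1 + ‖y‖) ^ (-(s / 2)) * (1 + ‖x + ρ (τ y)‖) ^ (-d) := by ring
      _ ≤ _ := by
          gcongr
          exact le_add_of_nonneg_right (by positivity)
  · have hΦd := contDiff_sliceAmplitude (M := M) hb.1 hc.1 τ y
    have hΦi : Integrable (sliceAmplitude b c M τ y) := by
      refine (((integrable_one_add_norm hd).comp_add_right (ρ (τ y))).const_mul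
        (C₁ * (1 + ‖y‖) ^ (-(s / 2)))).mono' hΦd.continuous.aestronglyMeasurable
        (.of_forall fun x => ?_)
      simpa using h₁ τ ρ h y 0 zero_le x
    have hF : ∀ ξ, ‖𝓕 (sliceAmplitude b c M τ y) ξ‖ ≤
        C₂ * (C₁ * (1 + ‖y‖) ^ (-(s / 2))) * (1 + ‖ξ‖) ^ (-(t + d)) := fun ξ => by
      refine (h₂ _ _ _ hΦd (h₁ τ ρ h y) ξ).trans ?_
      gcongr
      simp
    let S : X →L[ℝ] X := (2 * π)⁻¹ • ContinuousLinearMap.adjoint (1 - τ)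
    let S' : X →L[ℝ] X := (2 * π) • ContinuousLinearMap.adjoint ρ
    have hS : ∀ p x, (inner ℝ p ((1 - τ) x) : ℝ) = 2 * π * inner ℝ x (S p) := fun p x => by
      simp only [S, smul_apply, inner_smul_right,
        ContinuousLinearMap.adjoint_inner_right]
      rw [real_inner_comm]
      field_simp
    have hSn : ‖S‖ ≤ R' := by
      rw [norm_smul, LinearIsometryEquiv.norm_map, Real.norm_of_nonneg (by positivity)]
      calc (2 * π)⁻¹ * ‖1 - τ‖ ≤ 1 * R := by
            gcongr
            exacts [inv_le_one_of_one_le₀ hπ, h.norm_one_sub_le]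
        _ ≤ R' := by simp only [R']; gcongr
    have hSn' : ‖S'‖ ≤ R' := by
      rw [norm_smul, LinearIsometryEquiv.norm_map, Real.norm_of_nonneg (by positivity)]
      exact mul_le_mul_of_nonneg_left h.norm_inv_le (by positivity)
    have hinv : ∀ p, S' (S p) = p := fun p => by
      simp only [S, S', smul_apply, map_smul, h.adjoint_inv_adjoint_apply, smul_smul]
      rw [inv_mul_cancel₀ (by positivity), one_smul]
    have hfour := fourier_mul_expIntegral_comp hΦi hAi (1 - τ) S hS (τ y) w
    change ‖𝓕 (fun x => sliceAmplitude b c M τ y x * expIntegral A ((1 - τ) x + τ y)) w‖ ≤ _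
    rw [hfour]
    refine (norm_integral_phase_mul_comp_le ht0 hd hR' (B := C₂ * (C₁ * (1 + ‖y‖) ^ (-(s / 2))))
      (by positivity) hC₃ (fun p => ?_) h₃ hF hSn hSn' hinv w).trans ?_
    · rw [mul_comm I, norm_exp_ofReal_mul_I]
    · calc _ = C₃ * (C₂ * C₁) * (1 + R') ^ (t + d) * J' * (1 + ‖y‖) ^ (-(s / 2)) *
            (1 + ‖w‖) ^ (-t) := by ring
        _ ≤ _ := by
          gcongr
          exact le_add_of_nonneg_left (by positivity)

end Slices

/-! ### The operator (1-Δ)^(m/2) on L² functions. -/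

section FourierMultiplier

open FourierTransform Real

variable {X : Type*} [NormedAddCommGroup X] [InnerProductSpace ℝ X]

/-- The symbol of `(1 - Δ) ^ (m / 2)` for Mathlib's normalization of the Fourier transform. -/
noncomputable def laplacianSymbol (m : ℝ) (ξ : X) : ℂ :=
  (((1 + ‖(2 * π) • ξ‖ ^ 2) ^ (m / 2) : ℝ) : ℂ)

theorem hasTemperateGrowth_laplacianSymbol (m : ℝ) :
    (laplacianSymbol m : X → ℂ).HasTemperateGrowth := by
  have h := (Function.hasTemperateGrowth_one_add_norm_sq_rpow X (m / 2)).comp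
    (((2 * π) • ContinuousLinearMap.id ℝ X).hasTemperateGrowth)
  exact Function.Complex.hasTemperateGrowth_ofReal.comp h

theorem norm_laplacianSymbol_le {m : ℝ} (hm : 0 ≤ m) (ξ : X) :
    ‖(laplacianSymbol m ξ : ℂ)‖ ≤ (2 * π) ^ m * (1 + ‖ξ‖) ^ m := by
  have hξ := norm_nonneg ξ
  have hπ : 1 ≤ 2 * π := by linarith [Real.pi_gt_three]
  rw [laplacianSymbol, Complex.norm_real, Real.norm_of_nonneg (by positivity), norm_smul,
    Real.norm_of_nonneg (by positivity), ← Real.mul_rpow (by positivity) (by positivity)]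
  calc (1 + (2 * π * ‖ξ‖) ^ 2) ^ (m / 2) ≤ ((2 * π * (1 + ‖ξ‖)) ^ (2 : ℝ)) ^ (m / 2) := by
        gcongr
        rw [Real.rpow_two]
        nlinarith [mul_nonneg (by positivity : 0 ≤ (2 * π) ^ 2) hξ]
    _ = (2 * π * (1 + ‖ξ‖)) ^ m := by
        rw [← Real.rpow_mul (by positivity)]
        congr 1
        ring

variable [FiniteDimensional ℝ X] [MeasurableSpace X] [BorelSpace X]

/-- The distributional transform is defined by duality, and for integrable f the exchange formula
moves the transform from the test function to f. -/
theorem Lp.fourier_toTemperedDistribution_toLp {f : X → ℂ} (hf : Integrable f)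
    (hf2 : MemLp f 2 volume) (hF : MemLp (𝓕 f) 2 volume) :
    𝓕 (Lp.toTemperedDistribution (hf2.toLp f)) = Lp.toTemperedDistribution (hF.toLp (𝓕 f)) := by
  ext φ
  rw [TemperedDistribution.fourier_apply, Lp.toTemperedDistribution_apply,
    Lp.toTemperedDistribution_apply]
  have h1 : ∫ x, (𝓕 φ) x • (hf2.toLp f) x = ∫ x, 𝓕 (φ : X → ℂ) x • f x := by
    refine integral_congr_ae ?_
    filter_upwards [hf2.coeFn_toLp] with x hx
    rw [hx, SchwartzMap.fourier_coe]
  have h2 : ∫ x, φ x • (hF.toLp (𝓕 f)) x = ∫ x, φ x • 𝓕 f x := by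
    refine integral_congr_ae ?_
    filter_upwards [hF.coeFn_toLp] with x hx
    rw [hx]
  rw [h1, h2]
  have := VectorFourier.integral_fourierIntegral_smul_eq_flip (μ := volume) (ν := volume)
    (L := innerₗ X) continuous_fourierChar continuous_inner φ.integrable hf
  rwa [flip_innerₗ] at this

theorem smulLeftCLM_toTemperedDistribution_toLp {g f : X → ℂ} (hg : g.HasTemperateGrowth)
    (hf : MemLp f 2 volume) (hgf : MemLp (fun x => g x * f x) 2 volume) :
    TemperedDistribution.smulLeftCLM ℂ g (Lp.toTemperedDistribution (hf.toLp f)) =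
      Lp.toTemperedDistribution (hgf.toLp fun x => g x * f x) := by
  ext φ
  rw [TemperedDistribution.smulLeftCLM_apply_apply, Lp.toTemperedDistribution_apply,
    Lp.toTemperedDistribution_apply]
  refine integral_congr_ae ?_
  filter_upwards [hf.coeFn_toLp, hgf.coeFn_toLp] with x h1 h2
  rw [h1, h2, SchwartzMap.smulLeftCLM_apply_apply hg]
  simp only [smul_eq_mul]
  ring

/-- The inverse transform on L² agrees with the distributional one, so it suffices to compare the
two sides before inversion, where the operator is multiplication by its symbol. -/
theorem hasOneSubLaplacianPow_of_ae_eq {m : ℝ} {f w : X → ℂ} (hf : Integrable f)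
    (hf2 : MemLp f 2 volume) (hF : MemLp (𝓕 f) 2 volume)
    (hgF : MemLp (fun ξ => laplacianSymbol m ξ * 𝓕 f ξ) 2 volume)
    (hw : w =ᵐ[volume] (𝓕⁻ (hgF.toLp _) : Lp ℂ 2 (volume : Measure X))) :
    HasOneSubLaplacianPow m f w := by
  have hw2 : MemLp w 2 volume := (memLp_congr_ae hw).2 (Lp.memLp _)
  refine ⟨hf2, hw2, ?_⟩
  have h1 : hw2.toLp w = 𝓕⁻ (hgF.toLp _) := by
    refine Lp.ext ?_
    filter_upwards [hw2.coeFn_toLp, hw] with x h1 h2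
    rw [h1, h2]
  rw [h1, ← Lp.fourierInv_toTemperedDistribution_eq, oneSubLaplacianPow,
    TemperedDistribution.fourierMultiplierCLM_apply, Lp.fourier_toTemperedDistribution_toLp hf hf2 hF]
  congr 1
  exact smulLeftCLM_toTemperedDistribution_toLp (hasTemperateGrowth_laplacianSymbol m) hF hgF

theorem memLp_two_one_add_norm_rpow_neg {r : ℝ} (hr : (Module.finrank ℝ X : ℝ) < 2 * r) :
    MemLp (fun x : X => (1 + ‖x‖) ^ (-r)) 2 volume := by
  rw [memLp_two_iff_integrable_sq (Measurable.aestronglyMeasurable (by fun_prop))]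
  refine (integrable_one_add_norm hr).congr (.of_forall fun x => ?_)
  dsimp only
  rw [← Real.rpow_natCast, ← Real.rpow_mul (by positivity)]
  congr 1
  push_cast
  ring

end FourierMultiplier

/-! ### Local uniformity in τ and continuity of the family of slices. -/

section SliceFamily

open FourierTransform Real Filter Topology

variable {X : Type*} [NormedAddCommGroup X] [InnerProductSpace ℝ X] [FiniteDimensional ℝ X]

/-- At τ₀ = 1+σ the operator 1-τ₀ = -σ is invertible. Units are open and inversion is continuous
there, so nearby inverses exist and stay bounded. -/
theorem exists_eventually_isBoundedResolvent {τ₀ : X →L[ℝ] X} (h : τ₀ ∈ cordesU₁ X) :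
    ∃ R : ℝ, 0 ≤ R ∧ ∀ᶠ τ in 𝓝 τ₀, ∃ ρ, IsBoundedResolvent R τ ρ := by
  have := FiniteDimensional.complete ℝ X
  obtain ⟨σ, hσ, rfl⟩ := h
  have hu : IsUnit (1 - (1 + σ)) := by
    rw [sub_add_cancel_left]
    exact IsUnit.neg hσ
  set τ₀ : X →L[ℝ] X := 1 + σ
  have hc : ContinuousAt (fun τ : X →L[ℝ] X => (1 - τ)) τ₀ := by fun_prop
  have hinv : ContinuousAt (fun τ : X →L[ℝ] X => Ring.inverse (1 - τ)) τ₀ := by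
    obtain ⟨u, hu⟩ := hu
    refine ContinuousAt.comp (g := Ring.inverse) ?_ hc
    rw [← hu]
    exact NormedRing.inverse_continuousAt u
  have hunit : ∀ᶠ τ in 𝓝 τ₀, IsUnit (1 - τ) := hc.eventually (Units.isOpen.mem_nhds hu)
  refine ⟨‖τ₀‖ + 1 + (‖1 - τ₀‖ + 1) + (‖Ring.inverse (1 - τ₀)‖ + 1), by positivity, ?_⟩
  filter_upwards [hunit, continuousAt_id.norm.eventually_lt_const (lt_add_one ‖τ₀‖),
    hc.norm.eventually_lt_const (lt_add_one ‖1 - τ₀‖),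
    hinv.norm.eventually_lt_const (lt_add_one ‖Ring.inverse (1 - τ₀)‖)] with τ h1 h2 h3 h4
  have h2' : ‖τ‖ < ‖τ₀‖ + 1 := h2
  have := norm_nonneg τ₀
  have := norm_nonneg (1 - τ₀)
  have := norm_nonneg (Ring.inverse (1 - τ₀))
  exact ⟨Ring.inverse (1 - τ), by linarith, by linarith, by linarith,
    Ring.inverse_mul_cancel _ h1, Ring.mul_inverse_cancel _ h1⟩

variable [MeasurableSpace X] [BorelSpace X]

variable {A b c : X → ℂ} {M : ℕ}

theorem continuous_kernelSlice (hA : Integrable A) (hb : Continuous b) (x : X) :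
    Continuous fun z : (X →L[ℝ] X) × X => kernelSlice A b c M z.1 z.2 x := by
  have h1 := continuous_expIntegral hA
  have h2 : Continuous (bracketWeight M : X → ℂ) := (contDiff_bracketWeight M).continuous
  unfold kernelSlice sliceAmplitude
  fun_prop

theorem continuous_kernelSlice_right (hA : Integrable A) (hb : Continuous b) (hc : Continuous c)
    (τ : X →L[ℝ] X) (y : X) : Continuous (kernelSlice A b c M τ y) := by
  have h1 := continuous_expIntegral hA
  have h2 : Continuous (bracketWeight M : X → ℂ) := (contDiff_bracketWeight M).continuous
  change Continuous fun x => kernelSlice A b c M τ y x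
  unfold kernelSlice sliceAmplitude
  fun_prop

theorem continuous_fourier_of_integrable {f : X → ℂ} (hf : Integrable f) : Continuous (𝓕 f) :=
  VectorFourier.fourierIntegral_continuous continuous_fourierChar
    (by exact continuous_inner) hf

/-- The estimates on slices of the kernel that yield the Sobolev regularity, locally uniformly. -/
def HasSliceBound (A b c : X → ℂ) (M : ℕ) (s t d R C : ℝ) : Prop :=
  ∀ (τ ρ : X →L[ℝ] X), IsBoundedResolvent R τ ρ → ∀ y,
    (∀ x, ‖kernelSlice A b c M τ y x‖ ≤
      C * (1 + ‖y‖) ^ (-(s / 2)) * (1 + ‖x + ρ (τ y)‖) ^ (-d)) ∧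
    ∀ w, ‖𝓕 (kernelSlice A b c M τ y) w‖ ≤ C * (1 + ‖y‖) ^ (-(s / 2)) * (1 + ‖w‖) ^ (-t)

namespace HasSliceBound

variable {s t d R C m : ℝ}

theorem memLp_kernelSlice (h : HasSliceBound A b c M s t d R C) (hA : Integrable A)
    (hb : Continuous b) (hc : Continuous c) (hd : (Module.finrank ℝ X : ℝ) < 2 * d)
    {τ ρ : X →L[ℝ] X} (hτ : IsBoundedResolvent R τ ρ) (y : X) :
    MemLp (kernelSlice A b c M τ y) 2 volume := by
  have h1 := (memLp_two_one_add_norm_rpow_neg hd).comp_measurePreserving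
    (measurePreserving_add_right volume (ρ (τ y)))
  refine (h1.const_mul (C * (1 + ‖y‖) ^ (-(s / 2)))).mono'
    (continuous_kernelSlice_right hA hb hc τ y).aestronglyMeasurable (.of_forall fun x => ?_)
  exact (h τ ρ hτ y).1 x

theorem integrable_kernelSlice (h : HasSliceBound A b c M s t d R C) (hA : Integrable A)
    (hb : Continuous b) (hc : Continuous c) (hd : (Module.finrank ℝ X : ℝ) < d)
    {τ ρ : X →L[ℝ] X} (hτ : IsBoundedResolvent R τ ρ) (y : X) :
    Integrable (kernelSlice A b c M τ y) :=
  (((integrable_one_add_norm hd).comp_add_right (ρ (τ y))).const_mul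
    (C * (1 + ‖y‖) ^ (-(s / 2)))).mono'
    (continuous_kernelSlice_right hA hb hc τ y).aestronglyMeasurable
    (.of_forall (h τ ρ hτ y).1)

theorem norm_laplacianSymbol_mul_fourier_le (h : HasSliceBound A b c M s t d R C) (hm : 0 ≤ m)
    {τ ρ : X →L[ℝ] X} (hτ : IsBoundedResolvent R τ ρ) (y w : X) :
    ‖laplacianSymbol m w * 𝓕 (kernelSlice A b c M τ y) w‖ ≤
      (2 * π) ^ m * C * (1 + ‖y‖) ^ (-(s / 2)) * (1 + ‖w‖) ^ (-(t - m)) := by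
  rw [norm_mul]
  calc _ ≤ ((2 * π) ^ m * (1 + ‖w‖) ^ m) * (C * (1 + ‖y‖) ^ (-(s / 2)) * (1 + ‖w‖) ^ (-t)) := by
        gcongr
        exacts [norm_laplacianSymbol_le hm w, (h τ ρ hτ y).2 w]
    _ = (2 * π) ^ m * C * (1 + ‖y‖) ^ (-(s / 2)) * ((1 + ‖w‖) ^ m * (1 + ‖w‖) ^ (-t)) := by ring
    _ = _ := by
        rw [← Real.rpow_add (by positivity)]
        congr 2
        ring

theorem memLp_laplacianSymbol_mul_fourier (h : HasSliceBound A b c M s t d R C)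
    (hA : Integrable A) (hb : Continuous b) (hc : Continuous c)
    (hd : (Module.finrank ℝ X : ℝ) < d) (hm : 0 ≤ m)
    (hmt : (Module.finrank ℝ X : ℝ) < 2 * (t - m))
    {τ ρ : X →L[ℝ] X} (hτ : IsBoundedResolvent R τ ρ) (y : X) :
    MemLp (fun w => laplacianSymbol m w * 𝓕 (kernelSlice A b c M τ y) w) 2 volume := by
  refine ((memLp_two_one_add_norm_rpow_neg hmt).const_mul _).mono'
    (Continuous.aestronglyMeasurable ?_) (.of_forall (h.norm_laplacianSymbol_mul_fourier_le hm hτ y))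
  exact (hasTemperateGrowth_laplacianSymbol m).1.continuous.mul
    (continuous_fourier_of_integrable (h.integrable_kernelSlice hA hb hc hd hτ y))

theorem memLp_fourier (h : HasSliceBound A b c M s t d R C)
    (hA : Integrable A) (hb : Continuous b) (hc : Continuous c)
    (hd : (Module.finrank ℝ X : ℝ) < d) (ht : (Module.finrank ℝ X : ℝ) < 2 * t)
    {τ ρ : X →L[ℝ] X} (hτ : IsBoundedResolvent R τ ρ) (y : X) :
    MemLp (𝓕 (kernelSlice A b c M τ y)) 2 volume :=
  ((memLp_two_one_add_norm_rpow_neg ht).const_mul _).mono'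
    (continuous_fourier_of_integrable
      (h.integrable_kernelSlice hA hb hc hd hτ y)).aestronglyMeasurable
    (.of_forall (h τ ρ hτ y).2)

/-- The centre -ρ(τy) of the spatial bound moves with (τ,y) but stays in a ball of radius R²(|y₀|+1)
near (τ₀,y₀). A single multiple of (1+|x|)^(-d) therefore dominates all nearby slices. -/
theorem tendsto_fourier_kernelSlice (h : HasSliceBound A b c M s t d R C) (hA : Integrable A)
    (hb : Continuous b) (hc : Continuous c) (hs : 0 ≤ s) (hR : 0 ≤ R) (hC : 0 ≤ C)
    (hd : (Module.finrank ℝ X : ℝ) < d)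
    {τ₀ : X →L[ℝ] X} (hτ : ∀ᶠ τ in 𝓝 τ₀, ∃ ρ, IsBoundedResolvent R τ ρ) (y₀ w : X) :
    Tendsto (fun z : (X →L[ℝ] X) × X => 𝓕 (kernelSlice A b c M z.1 z.2) w) (𝓝 (τ₀, y₀))
      (𝓝 (𝓕 (kernelSlice A b c M τ₀ y₀) w)) := by
  have hd0 : 0 ≤ d := (Nat.cast_nonneg _).trans hd.le
  simp only [Real.fourier_eq', smul_eq_mul]
  have hy : ∀ᶠ y in 𝓝 y₀, ‖y‖ < ‖y₀‖ + 1 :=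
    continuous_norm.continuousAt.eventually_lt_const (lt_add_one _)
  refine tendsto_integral_filter_of_dominated_convergence
    (fun x => C * ((1 + R * (R * (‖y₀‖ + 1))) ^ d * (1 + ‖x‖) ^ (-d))) (.of_forall fun z => ?_) ?_
    (((integrable_one_add_norm hd).const_mul _).const_mul _) (.of_forall fun x => ?_)
  · have := continuous_kernelSlice_right (M := M) hA hb hc z.1 z.2
    exact Continuous.aestronglyMeasurable (by fun_prop)
  · filter_upwards [hτ.prod_nhds hy] with z hz
    obtain ⟨⟨ρ, hρ⟩, hzy⟩ := hz
    refine .of_forall fun x => ?_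
    rw [norm_mul, Complex.norm_exp_ofReal_mul_I, one_mul]
    have h1 : 1 + ‖x‖ ≤ (1 + R * (R * (‖y₀‖ + 1))) * (1 + ‖x + ρ (z.1 z.2)‖) := by
      calc 1 + ‖x‖ = 1 + ‖-(ρ (z.1 z.2)) + (x + ρ (z.1 z.2))‖ := by congr 2; abel
        _ ≤ (1 + ‖ρ (z.1 z.2)‖) * (1 + ‖x + ρ (z.1 z.2)‖) := by
            simpa using one_add_norm_add_le (-(ρ (z.1 z.2))) (x + ρ (z.1 z.2))
        _ ≤ _ := by
            gcongr
            calc ‖ρ (z.1 z.2)‖ ≤ ‖ρ‖ * (‖z.1‖ * ‖z.2‖) :=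
                  (ρ.le_opNorm _).trans (by gcongr; exact z.1.le_opNorm _)
              _ ≤ R * (R * (‖y₀‖ + 1)) := by
                  gcongr
                  exacts [hρ.norm_inv_le, hρ.norm_le]
    have h2 : (1 + ‖x + ρ (z.1 z.2)‖) ^ (-d) ≤
        (1 + R * (R * (‖y₀‖ + 1))) ^ d * (1 + ‖x‖) ^ (-d) := by
      rw [Real.rpow_neg (by positivity), Real.rpow_neg (by positivity), ← div_eq_mul_inv,
        le_div_iff₀ (by positivity), inv_mul_le_iff₀ (by positivity), mul_comm,
        ← Real.mul_rpow (by positivity) (by positivity)]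
      gcongr
    calc _ ≤ C * (1 + ‖z.2‖) ^ (-(s / 2)) * (1 + ‖x + ρ (z.1 z.2)‖) ^ (-d) :=
          (h z.1 ρ hρ z.2).1 x
      _ ≤ C * 1 * ((1 + R * (R * (‖y₀‖ + 1))) ^ d * (1 + ‖x‖) ^ (-d)) := by
          gcongr
          exact Real.rpow_le_one_of_one_le_of_nonpos (by simp) (by linarith)
      _ = _ := by ring
  · exact ((continuous_kernelSlice hA hb x).tendsto (τ₀, y₀)).const_mul _

end HasSliceBound

/-- W is the inverse Plancherel transform of the symbol times the transform of the slice, so norm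
bounds and continuity can be proved on the frequency side. -/
theorem exists_sobolev_slice_family {s t d m : ℝ} (hs : (Module.finrank ℝ X : ℝ) < s)
    (ht : (Module.finrank ℝ X : ℝ) < 2 * t) (hd : (Module.finrank ℝ X : ℝ) < d) (hm : 0 ≤ m)
    (hmt : (Module.finrank ℝ X : ℝ) < 2 * (t - m)) (hA : Integrable A) (hb : Continuous b)
    (hc : Continuous c) (H : ∀ R, 0 ≤ R → ∃ C, 0 ≤ C ∧ HasSliceBound A b c M s t d R C) :
    ∃ W : cordesU₁ X → X → Lp ℂ 2 (volume : Measure X),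
      (Continuous fun z : cordesU₁ X × X => W z.1 z.2) ∧
      (∀ τ₀, ∃ g : X → ℝ, MemLp g 2 volume ∧ ∀ᶠ τ in 𝓝 τ₀, ∀ y, ‖W τ y‖ ≤ g y) ∧
      ∀ (τ : cordesU₁ X) (y : X) (w : X → ℂ), w =ᵐ[volume] W τ y →
        HasOneSubLaplacianPow m (kernelSlice A b c M τ y) w := by
  have hs0 : 0 ≤ s := (Nat.cast_nonneg _).trans hs.le
  have hd2 : (Module.finrank ℝ X : ℝ) < 2 * d := by
    have : (0 : ℝ) ≤ Module.finrank ℝ X := Nat.cast_nonneg _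
    linarith
  have hloc : ∀ τ₀ : cordesU₁ X, ∃ R C, 0 ≤ R ∧ 0 ≤ C ∧ HasSliceBound A b c M s t d R C ∧
      ∀ᶠ τ in 𝓝 (τ₀ : X →L[ℝ] X), ∃ ρ, IsBoundedResolvent R τ ρ := fun τ₀ => by
    obtain ⟨R, hR, hτ⟩ := exists_eventually_isBoundedResolvent τ₀.2
    obtain ⟨C, hC, h⟩ := H R hR
    exact ⟨R, C, hR, hC, h, hτ⟩
  have hmem : ∀ (τ : cordesU₁ X) (y : X),
      MemLp (fun w => laplacianSymbol m w * 𝓕 (kernelSlice A b c M τ y) w) 2 volume :=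
    fun τ y => by
      obtain ⟨R, C, hR, hC, h, hτ⟩ := hloc τ
      obtain ⟨ρ, hρ⟩ := hτ.self_of_nhds
      exact h.memLp_laplacianSymbol_mul_fourier hA hb hc hd hm hmt hρ y
  have hJ := memLp_two_one_add_norm_rpow_neg hmt
  refine ⟨fun τ y => 𝓕⁻ ((hmem τ y).toLp _), ?_, fun τ₀ => ?_, fun τ y w hw => ?_⟩
  · have hcont : Continuous fun z : cordesU₁ X × X => (hmem z.1 z.2).toLp _ := by
      refine continuous_iff_continuousAt.2 fun ⟨τ₀, y₀⟩ => ?_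
      rw [ContinuousAt, Lp.tendsto_Lp_iff_tendsto_eLpNorm'']
      obtain ⟨R, C, hR, hC, h, hτ⟩ := hloc τ₀
      have hval : Tendsto (fun z : cordesU₁ X × X => ((z.1 : X →L[ℝ] X), z.2)) (𝓝 (τ₀, y₀))
          (𝓝 ((τ₀ : X →L[ℝ] X), y₀)) :=
        Continuous.tendsto (by fun_prop) _
      have hτ' : ∀ᶠ z : cordesU₁ X × X in 𝓝 (τ₀, y₀),
          ∃ ρ, IsBoundedResolvent R (z.1 : X →L[ℝ] X) ρ := hval.fst_nhds.eventually hτ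
      have hle : ∀ᶠ z : cordesU₁ X × X in 𝓝 (τ₀, y₀), ∀ᵐ w,
          ‖laplacianSymbol m w * 𝓕 (kernelSlice A b c M z.1 z.2) w‖ ≤
            (2 * π) ^ m * C * (1 + ‖w‖) ^ (-(t - m)) := by
        filter_upwards [hτ'] with z ⟨ρ, hρ⟩
        refine .of_forall fun w => (h.norm_laplacianSymbol_mul_fourier_le hm hρ z.2 w).trans ?_
        -- For continuity the decay in y is dropped, which leaves a majorant independent of (τ,y).
        have h1 : (1 + ‖z.2‖) ^ (-(s / 2)) ≤ 1 :=
          Real.rpow_le_one_of_one_le_of_nonpos (by simp) (by linarith)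
        exact mul_le_mul_of_nonneg_right (mul_le_of_le_one_right (by positivity) h1) (by positivity)
      exact tendsto_eLpNorm_two_sub_of_dominated (fun z => (hmem z.1 z.2).1) (hmem τ₀ y₀).1
        (hJ.const_mul _) hle hle.self_of_nhds (.of_forall fun w =>
          ((h.tendsto_fourier_kernelSlice hA hb hc hs0 hR hC hd hτ y₀ w).comp hval).const_mul _)
    exact (Lp.fourierTransformₗᵢ X ℂ).symm.continuous.comp hcont
  · obtain ⟨R, C, hR, hC, h, hτ⟩ := hloc τ₀
    have hs' : (Module.finrank ℝ X : ℝ) < 2 * (s / 2) := by linarith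
    refine ⟨fun y => (2 * π) ^ m * C * ‖hJ.toLp _‖ * (1 + ‖y‖) ^ (-(s / 2)),
      (memLp_two_one_add_norm_rpow_neg hs').const_mul _, ?_⟩
    filter_upwards [continuousAt_subtype_val.eventually hτ] with τ ⟨ρ, hρ⟩ y
    have h1 : ‖(𝓕⁻ ((hmem τ y).toLp _) : Lp ℂ 2 (volume : Measure X))‖ = ‖(hmem τ y).toLp _‖ :=
      (Lp.fourierTransformₗᵢ X ℂ).symm.norm_map _
    rw [h1]
    calc _ ≤ ((2 * π) ^ m * C * (1 + ‖y‖) ^ (-(s / 2))) * ‖hJ.toLp _‖ := by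
          refine Lp.norm_le_mul_norm_of_ae_le_mul ?_
          filter_upwards [(hmem τ y).coeFn_toLp, hJ.coeFn_toLp] with w h1 h2
          rw [h1, h2]
          refine (h.norm_laplacianSymbol_mul_fourier_le hm hρ y w).trans ?_
          gcongr
          exact Real.le_norm_self _
      _ = _ := by ring
  · obtain ⟨R, C, hR, hC, h, hτ⟩ := hloc τ
    obtain ⟨ρ, hρ⟩ := hτ.self_of_nhds
    exact hasOneSubLaplacianPow_of_ae_eq (h.integrable_kernelSlice hA hb hc hd hρ y)
      (h.memLp_kernelSlice hA hb hc hd2 hρ y) (h.memLp_fourier hA hb hc hd ht hρ y) (hmem τ y) hw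

end SliceFamily

/-! ### Assembly of the kernels. -/

section CordesKernel

open Filter Topology

variable {X : Type*} [NormedAddCommGroup X] [InnerProductSpace ℝ X] [FiniteDimensional ℝ X]
  [MeasurableSpace X] [BorelSpace X]

theorem HasDerivGrowth.const_mul {V : Type*} [NormedAddCommGroup V] [NormedSpace ℝ V] {r : ℝ}
    {f : V → ℂ} (hf : HasDerivGrowth r f) (κ : ℂ) : HasDerivGrowth r (fun x => κ * f x) := by
  refine ⟨contDiff_const.mul hf.1, fun k => ?_⟩
  obtain ⟨C, hC, h⟩ := hf.2 k
  refine ⟨‖κ‖ * C, by positivity, fun x => ?_⟩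
  have : iteratedFDeriv ℝ k (fun x => κ * f x) x = κ • iteratedFDeriv ℝ k f x :=
    iteratedFDeriv_const_smul_apply (a := κ) (hf.1.contDiffAt.of_le (by exact_mod_cast le_top))
  rw [this, norm_smul, mul_assoc]
  gcongr
  exact h x

theorem exists_kernelSlice_eq {t : ℝ} (ht : (Module.finrank ℝ X : ℝ) < t)
    {a : StrongDual ℝ X → ℂ} (ha : HasDerivGrowth (-t) a) (b c : X → ℂ) (M : ℕ) :
    ∃ A : X → ℂ, HasDerivGrowth (-t) A ∧ ∀ τ y,
      kernelSlice A b c M τ y = fun x => c x * cordesKernel a b τ x y := by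
  set κ : ℂ := ((((2 * Real.pi) ^ Module.finrank ℝ X)⁻¹ : ℝ) : ℂ) with hκ
  have ha' := (ha.comp_linearIsometryEquiv (InnerProductSpace.toDual ℝ X)).const_mul κ
  obtain ⟨A, hA, h⟩ := exists_expIntegral_eq_one_add_norm_sq_pow_mul ht ha' M
  refine ⟨A, hA, fun τ y => funext fun x => ?_⟩
  have h1 : ∀ v, bracketWeight M v * expIntegral A v = invFourierDual a v := fun v => by
    have h2 : expIntegral (fun p => κ * a (InnerProductSpace.toDual ℝ X p)) v =
        invFourierDual a v := by
      rw [invFourierDual_eq_expIntegral, ← hκ, expIntegral, expIntegral, ← integral_const_mul]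
      congr 1
      ext p
      ring
    have hne : ((1 + ‖v‖ ^ 2 : ℝ) : ℂ) ^ M ≠ 0 := by
      have : (0 : ℝ) < 1 + ‖v‖ ^ 2 := by positivity
      exact pow_ne_zero _ (by exact_mod_cast this.ne')
    rw [h, h2, bracketWeight, Real.rpow_neg (by positivity), Real.rpow_natCast, Complex.ofReal_inv,
      Complex.ofReal_pow, inv_mul_cancel_left₀ hne]
  rw [kernelSlice, sliceAmplitude, cordesKernel, ← h1]
  ring

/-- Requiring only growth bounds on derivatives allows a second application with b reflected, which
yields part (ii). -/
theorem exists_cordesKernel_family {s t m : ℝ} (hs : (Module.finrank ℝ X : ℝ) < s)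
    (ht : (Module.finrank ℝ X : ℝ) < t) (hm : 0 ≤ m) (hm₂ : m < t / 2)
    {a : StrongDual ℝ X → ℂ} {b c : X → ℂ}
    (ha : HasDerivGrowth (-t) a) (hb : HasDerivGrowth (-s) b) (hc : HasDerivGrowth (s / 2) c) :
    ∃ (K : (X →L[ℝ] X) → X × X → ℂ)
        (hK : ∀ τ ∈ cordesU₁ X, MemLp (K τ) 2 (volume : Measure (X × X))),
      (∀ τ ∈ cordesU₁ X, ∀ y : X,
        HasOneSubLaplacianPow m (fun x => c x * cordesKernel a b τ x y) (fun x => K τ (x, y))) ∧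
      Continuous (fun τ : cordesU₁ X => (hK τ.1 τ.2).toLp (K τ.1)) := by
  -- Any d > n would do: d only serves to make (1+|x|)^(-d) integrable.
  set d : ℝ := Module.finrank ℝ X + 1 with hd
  have hn : (0 : ℝ) ≤ Module.finrank ℝ X := Nat.cast_nonneg _
  have hdn : (Module.finrank ℝ X : ℝ) < d := by linarith
  obtain ⟨k, hk⟩ := exists_nat_ge (t + d)
  obtain ⟨M, C', -, hM⟩ := exists_norm_iteratedFDeriv_bracketWeight_le (X := X) (s + d) k
  obtain ⟨A, hA, hAK⟩ := exists_kernelSlice_eq ht ha b c M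
  obtain ⟨W, hWc, hWb, hWS⟩ := exists_sobolev_slice_family (M := M) (d := d) (t := t) (m := m) hs
    (by linarith) hdn hm (by linarith) (hA.integrable ht) hb.1.continuous hc.1.continuous
    fun R hR => exists_norm_kernelSlice_le (by linarith) ht hdn hR hA hb hc hk hM
  obtain ⟨K, hK, hKW, hKc⟩ := exists_memLp_prod_representative (ν := volume) W hWc hWb
  -- The kernel must be given for every endomorphism; off U₁ it is set to 0.
  have hext : ∀ τ : cordesU₁ X, Function.extend Subtype.val K 0 τ.1 = K τ := fun τ =>
    Subtype.val_injective.extend_apply K 0 τ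
  refine ⟨Function.extend Subtype.val K 0, fun τ hτ => ?_, fun τ hτ y => ?_, ?_⟩
  · rw [hext ⟨τ, hτ⟩]
    exact hK _
  · rw [hext ⟨τ, hτ⟩, ← hAK]
    exact hWS ⟨τ, hτ⟩ y _ (hKW _ _)
  · refine hKc.congr fun τ => ?_
    exact MemLp.toLp_congr _ _ (by rw [hext τ])

end CordesKernel

theorem mainTheorem10 {X : Type*} [NormedAddCommGroup X] [InnerProductSpace ℝ X]
    [FiniteDimensional ℝ X] [MeasurableSpace X] [BorelSpace X]
    (s t m : ℝ) (hs : (Module.finrank ℝ X : ℝ) < s) (ht : (Module.finrank ℝ X : ℝ) < t)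
    (hm₁ : (Module.finrank ℝ X : ℝ) / 2 < m) (hm₂ : m < t / 2)
    (a : StrongDual ℝ X → ℂ) (b c : X → ℂ)
    (ha : IsSymbol (-t) a) (hb : IsSymbol (-s) b) (hc : IsSymbol (s / 2) c) :
    (∃ (K : (X →L[ℝ] X) → X × X → ℂ)
        (hK : ∀ τ ∈ cordesU₁ X, MemLp (K τ) 2 (volume : Measure (X × X))),
      (∀ τ ∈ cordesU₁ X, ∀ y : X,
        HasOneSubLaplacianPow m (fun x => c x * cordesKernel a b τ x y) (fun x => K τ (x, y))) ∧
      Continuous (fun τ : cordesU₁ X => (hK τ.1 τ.2).toLp (K τ.1))) ∧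
    (∃ (K : (X →L[ℝ] X) → X × X → ℂ)
        (hK : ∀ τ ∈ cordesU₀ X, MemLp (K τ) 2 (volume : Measure (X × X))),
      (∀ τ ∈ cordesU₀ X, ∀ x : X,
        HasOneSubLaplacianPow m (fun y => c y * cordesKernel a b τ x y) (fun y => K τ (x, y))) ∧
      Continuous (fun τ : cordesU₀ X => (hK τ.1 τ.2).toLp (K τ.1))) := by

  have hn : (0 : ℝ) ≤ Module.finrank ℝ X := Nat.cast_nonneg _
  have hm : 0 ≤ m := by linarith
  refine ⟨exists_cordesKernel_family hs ht hm hm₂ ha.hasDerivGrowth hb.hasDerivGrowth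
    hc.hasDerivGrowth, ?_⟩
  -- With b⁻(z) = b(-z), K_{a,b}(x,y;τ) = K_{a,b⁻}(y,x;1-τ), and 1-τ lies in U₁ when τ is
  -- invertible.
  obtain ⟨K, hK, hKS, hKc⟩ := exists_cordesKernel_family hs ht hm hm₂ ha.hasDerivGrowth
    (hb.hasDerivGrowth.comp_linearIsometryEquiv (LinearIsometryEquiv.neg ℝ)) hc.hasDerivGrowth
  have hU : ∀ τ ∈ cordesU₀ X, 1 - τ ∈ cordesU₁ X := fun τ hτ =>
    ⟨-τ, IsUnit.neg hτ, (sub_eq_add_neg 1 τ).symm⟩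
  have hswap : MeasurePreserving Prod.swap (volume : Measure (X × X)) volume :=
    Measure.measurePreserving_swap
  refine ⟨fun τ z => K (1 - τ) z.swap, fun τ hτ =>
    (hK _ (hU τ hτ)).comp_measurePreserving hswap, fun τ hτ x => ?_, ?_⟩
  · have h := hKS _ (hU τ hτ) x
    have hfun : (fun y => c y * cordesKernel a (fun z => b (LinearIsometryEquiv.neg ℝ z)) (1 - τ) y x)
        = fun y => c y * cordesKernel a b τ x y := by
      ext y
      simp [cordesKernel, add_comm]
    rw [hfun] at h
    exact h
  · have h1 : Continuous fun τ : cordesU₀ X => (⟨1 - τ.1, hU τ.1 τ.2⟩ : cordesU₁ X) := by fun_prop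
    exact (Lp.isometry_compMeasurePreserving hswap).continuous.comp (hKc.comp h1)
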